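/- Let $(w_k)_{k\ge 0}$ be a sequence of non-negative real numbers with $w_0>0$ and $w_k>0$ for some $k\ge 1$. For integers $m\ge 0$, $n\ge 1$, let $Z(m,n)=\sum \prod_{i=1}^n w_{y_i}$, the sum being over all $(y_1,\dots,y_n)\in\{0,1,2,\dots\}^n$ with $y_1+\dots+y_n=m$. If $Z(m,n)>0$, let $(Y_1,\dots,Y_n)$ be the random allocation of $m$ balls in $n$ boxes that equals each such $(y_1,\dots,y_n)$ with probability $\prod_{i=1}^n w_{y_i}/Z(m,n)$, and let $Y_{(1)}\ge Y_{(2)}\ge\dots\ge Y_{(n)}$ be $Y_1,\dots,Y_n$ arranged in decreasing order. Let $\Phi(t)=\sum_{k\ge0} w_k t^k$, let $\rho\in[0,\infty]$ be its radius of convergence, let $\Psi(t)=t\Phi'(t)/\Phi(t)=\sum_k k w_kt^k/\sum_k w_kt^k$ for those $t\in[0,\rho]$ with $\Phi(t)<\infty$, let $\Psi(\rho)=\lim_{t\uparrow\rho}\Psi(t)$ if $\Phi(\rho)=\infty$, and let $\nu=\Psi(\rho)\in[0,\infty]$. Suppose that $n\to\infty$ (along a sequence of integers) and that $m=m(n)$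 satisfies $Z(m,n)>0$ and $m/n\to\lambda$, where $0<\lambda<\nu$. Then there is a unique $\tau\in[0,\rho]$ with $\Psi(\tau)=\lambda$; it satisfies $0<\tau<\rho$; and, with $1/\log(\rho/\tau)$ read as $0$ if $\rho=\infty$, the following hold. (i) $Y_{(1)}\le \frac{1}{\log(\rho/\tau)}\log n+o_p(\log n)$, where $o_p(\log n)$ denotes random variables $X_n$ with $X_n/\log n\to0$ in probability. (ii) In particular, if $\rho=\infty$, then $Y_{(1)}=o_p(\log n)$. (iii) If, moreover, $w_k^{1/k}\to 1/\rho$ as $k\to\infty$, then for every fixed $j\ge1$, $\frac{Y_{(j)}}{\log n}\to\frac1{\log(\rho/\tau)}$ in probability. -/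

import Mathlib

open scoped NNReal ENNReal Topology

noncomputable section

namespace BallsInBoxes

/-- The generating function `Φ(t) = ∑ w_k t^k` of the weight sequence `w`, for `t ∈ [0,∞]`. -/
def genFun (w : ℕ → ℝ≥0) (t : ℝ≥0∞) : ℝ≥0∞ := ∑' k : ℕ, (w k : ℝ≥0∞) * t ^ k

/-- The radius of convergence `ρ ∈ [0,∞]` of the power series `∑ w_k z^k`. -/
def rho (w : ℕ → ℝ≥0) : ℝ≥0∞ :=
  (FormalMultilinearSeries.ofScalars ℝ (fun k => (w k : ℝ))).radius

/-- The quotient `t Φ'(t) / Φ(t) = (∑ k w_k t^k) / (∑ w_k t^k)`. -/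
def psiQuot (w : ℕ → ℝ≥0) (t : ℝ≥0∞) : ℝ≥0∞ :=
  (∑' k : ℕ, (k : ℝ≥0∞) * (w k : ℝ≥0∞) * t ^ k) / genFun w t

open Classical in
/-- The function `Ψ` on `[0,ρ]`: it is `t Φ'(t) / Φ(t)` where `Φ(t) < ∞`, and otherwise (on `[0,ρ]`
this can only happen at `t = ρ`) it is the limit of `s Φ'(s) / Φ(s)` as `s ↑ t`. -/
def Psi (w : ℕ → ℝ≥0) (t : ℝ≥0∞) : ℝ≥0∞ :=
  if genFun w t < ⊤ then psiQuot w t else Filter.limUnder (𝓝[<] t) (psiQuot w)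

/-- `ν = Ψ(ρ)`. -/
def nu (w : ℕ → ℝ≥0) : ℝ≥0∞ := Psi w (rho w)

/-- The weight `w(y) = ∏ w_{y_i}` of an allocation `y = (y_1, …, y_n)`. -/
def weight (w : ℕ → ℝ≥0) {n : ℕ} (y : Fin n → ℕ) : ℝ≥0 := ∏ i, w (y i)

/-- The finite set of allocations of `m` balls in `n` boxes: all `y ∈ ℕ^n` with `∑ y_i = m`. -/
def allocations (m n : ℕ) : Finset (Fin n → ℕ) := Finset.piAntidiag Finset.univ m

theorem mem_allocations {m n : ℕ} {y : Fin n → ℕ} : y ∈ allocations m n ↔ ∑ i, y i = m := by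
  simp [allocations]

/-- The partition function `Z(m,n)`. -/
def partitionFun (w : ℕ → ℝ≥0) (m n : ℕ) : ℝ≥0 := ∑ y ∈ allocations m n, weight w y

/-- The law of the random allocation of `m` balls in `n` boxes: each allocation `y` has probability
`w(y) / Z(m,n)`. It is meaningful only if `Z(m,n) > 0`. -/
def allocLaw (w : ℕ → ℝ≥0) (m n : ℕ) : MeasureTheory.Measure (Fin n → ℕ) :=
  ∑ y ∈ allocations m n,
    ((weight w y / partitionFun w m n : ℝ≥0) : ℝ≥0∞) • MeasureTheory.Measure.dirac y

theorem isProbabilityMeasure_allocLaw (w : ℕ → ℝ≥0) (m n : ℕ) (h : 0 < partitionFun w m n) :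
    MeasureTheory.IsProbabilityMeasure (allocLaw w m n) := by
  constructor
  simp only [allocLaw, MeasureTheory.Measure.coe_finsetSum, Finset.sum_apply,
    MeasureTheory.Measure.smul_apply, MeasureTheory.measure_univ, smul_eq_mul, mul_one]
  rw [← ENNReal.ofNNReal_finsetSum, ← Finset.sum_div]
  change ((partitionFun w m n / partitionFun w m n : ℝ≥0) : ℝ≥0∞) = 1
  rw [div_self h.ne', ENNReal.coe_one]

/-- `nthLargest y j` is the `j`-th largest (`j = 1, …, n`) of the numbers `y_1, …, y_n`, i.e. the
`j`-th entry when they are arranged in decreasing order (it is `0` by convention if `j > n`). -/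
def nthLargest {n : ℕ} (y : Fin n → ℕ) (j : ℕ) : ℕ :=
  ((Finset.univ.val.map y).sort (· ≥ ·)).getD (j - 1) 0

/-- Convergence in probability to a constant `c` of real random variables `X_i`, where `X_i` is
defined on its own probability space `(Ω_i, P_i)`. -/
def TendstoInProb {Ω : ℕ → Type*} [∀ i, MeasurableSpace (Ω i)]
    (P : ∀ i, MeasureTheory.Measure (Ω i)) (X : ∀ i, Ω i → ℝ) (c : ℝ) : Prop :=
  ∀ ε : ℝ, 0 < ε →
    Filter.Tendsto (fun i => P i {x | ε ≤ |X i x - c|}) Filter.atTop (𝓝 0)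

/-- `X_i = o_p(a_i)`, i.e. `X_i / a_i → 0` in probability. -/
def IsLittleOp {Ω : ℕ → Type*} [∀ i, MeasurableSpace (Ω i)]
    (P : ∀ i, MeasureTheory.Measure (Ω i)) (X : ∀ i, Ω i → ℝ) (a : ℕ → ℝ) : Prop :=
  TendstoInProb P (fun i x => X i x / a i) 0

open Classical in
/-- The constant `1 / log(ρ/τ)` for `0 < τ < ρ ≤ ∞`, read as `0` if `ρ = ∞`. -/
def invLogRatio (ρ τ : ℝ≥0∞) : ℝ :=
  if ρ = ⊤ then 0 else 1 / Real.log (ρ.toReal / τ.toReal)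

end BallsInBoxes

end

/-!
For every `t` inside the radius of convergence, the allocation is a sequence of `n` i.i.d. variables
with law `p_k = w_k t ^ k / Φ(t)`, conditioned on having sum `m`; take `t` with `Ψ(t) = m / n`, so
that `m` is the mean of the sum. By the local limit theorem the event conditioned on has probability
of exact order `n ^ (-1/2)`, and Fourier inversion bounds the point probabilities of the sum over
any half of the boxes by the same order. Hence prescribing the contents of at most half of the boxes
is at most a constant factor more likely than it would be for independent contents. As `p_k` decays
like `(τ / ρ) ^ k`, a union bound over single boxes gives the upper bound on `Y_(1)`; if `Y_(j)` is
small, then one of `j` fixed disjoint blocks of about `n / (2 j)` boxes contains no box with a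
prescribed content `k ≈ b log n`, which is unlikely as soon as `n p_k → ∞`.
-/

open Filter MeasureTheory
open scoped Real

namespace BallsInBoxes

/-! ### The functions `Φ` and `Ψ` inside the interval of convergence -/

section PowerSeries

variable {w : ℕ → ℝ≥0}

/-- The half-open interval `[0, ρ)`, as a set of real numbers. -/
def convergenceInterval (w : ℕ → ℝ≥0) : Set ℝ := {r | 0 ≤ r ∧ ENNReal.ofReal r < rho w}

theorem mem_convergenceInterval_of_le {r s : ℝ} (hs : s ∈ convergenceInterval w) (hr : 0 ≤ r)
    (hrs : r ≤ s) : r ∈ convergenceInterval w :=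
  ⟨hr, (ENNReal.ofReal_le_ofReal hrs).trans_lt hs.2⟩

theorem exists_ofReal_eq_of_lt_rho {s : ℝ≥0∞} (hs : s < rho w) :
    ∃ r ∈ convergenceInterval w, ENNReal.ofReal r = s :=
  have h := ENNReal.ofReal_toReal hs.ne_top
  ⟨s.toReal, ⟨ENNReal.toReal_nonneg, by rwa [h]⟩, h⟩

theorem exists_gt_mem_convergenceInterval {r : ℝ} (hr : r ∈ convergenceInterval w) :
    ∃ R ∈ convergenceInterval w, r < R := by
  obtain ⟨s, hrs, hsρ⟩ := exists_between hr.2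
  obtain ⟨R, hR, rfl⟩ := exists_ofReal_eq_of_lt_rho hsρ
  exact ⟨R, hR, (ENNReal.ofReal_lt_ofReal_iff_of_nonneg hr.1).1 hrs⟩

theorem convergenceInterval_mem_nhds {r : ℝ} (hr : r ∈ convergenceInterval w) (hr0 : 0 < r) :
    convergenceInterval w ∈ 𝓝 r := by
  obtain ⟨R, hR, hrR⟩ := exists_gt_mem_convergenceInterval hr
  filter_upwards [Icc_mem_nhds hr0 hrR] with x hx
  exact mem_convergenceInterval_of_le hR hx.1 hx.2

theorem summable_pow_mul_weight {r : ℝ} (hr : r ∈ convergenceInterval w) (j : ℕ) :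
    Summable fun k : ℕ => (k : ℝ) ^ j * ((w k : ℝ) * r ^ k) := by
  obtain ⟨R, hR, hrR⟩ := exists_gt_mem_convergenceInterval hr
  have hr0 := hr.1
  have hR0 : 0 < R := hr0.trans_lt hrR
  have hs : Summable fun k : ℕ => (w k : ℝ) * R ^ k := by
    simpa [FormalMultilinearSeries.ofScalars_norm, hR0.le]
      using FormalMultilinearSeries.summable_norm_mul_pow _ hR.2
  have hq : ‖r / R‖ < 1 := by
    rwa [Real.norm_of_nonneg (by positivity), div_lt_one hR0]
  obtain ⟨M, hM⟩ := hs.tendsto_atTop_zero.bddAbove_range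
  refine Summable.of_nonneg_of_le (fun k => by positivity) (fun k => ?_)
    ((summable_pow_mul_geometric_of_norm_lt_one j hq).mul_left M)
  calc (k : ℝ) ^ j * ((w k : ℝ) * r ^ k)
      = ((w k : ℝ) * R ^ k) * ((k : ℝ) ^ j * (r / R) ^ k) := by
        rw [div_pow]; field_simp
    _ ≤ M * ((k : ℝ) ^ j * (r / R) ^ k) := by gcongr; exact hM ⟨k, rfl⟩

theorem summable_weight {r : ℝ} (hr : r ∈ convergenceInterval w) :
    Summable fun k : ℕ => (w k : ℝ) * r ^ k := by
  simpa using summable_pow_mul_weight hr 0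

theorem summable_mul_weight {r : ℝ} (hr : r ∈ convergenceInterval w) :
    Summable fun k : ℕ => (k : ℝ) * ((w k : ℝ) * r ^ k) := by
  simpa using summable_pow_mul_weight hr 1

theorem continuousOn_tsum_pow_mul_weight (j : ℕ) :
    ContinuousOn (fun r : ℝ => ∑' k : ℕ, (k : ℝ) ^ j * ((w k : ℝ) * r ^ k))
      (convergenceInterval w) := by
  intro r hr
  obtain ⟨R, hR, hrR⟩ := exists_gt_mem_convergenceInterval hr
  have hcont : ContinuousOn (fun r : ℝ => ∑' k : ℕ, (k : ℝ) ^ j * ((w k : ℝ) * r ^ k))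
      (Set.Icc 0 R) := by
    refine continuousOn_tsum (fun k => by fun_prop) (summable_pow_mul_weight hR j) ?_
    rintro k x ⟨hx0, hxR⟩
    rw [Real.norm_of_nonneg (by positivity)]
    gcongr
  refine (hcont r ⟨hr.1, hrR.le⟩).mono_of_mem_nhdsWithin ?_
  filter_upwards [self_mem_nhdsWithin, nhdsWithin_le_nhds (Iic_mem_nhds hrR)] with x hx hxR
  exact ⟨hx.1, hxR⟩

/-- `Φ(r)` for real `r`. -/
noncomputable def realGen (w : ℕ → ℝ≥0) (r : ℝ) : ℝ := ∑' k : ℕ, (w k : ℝ) * r ^ k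

/-- `r Φ'(r)` for real `r`. -/
noncomputable def realNum (w : ℕ → ℝ≥0) (r : ℝ) : ℝ := ∑' k : ℕ, (k : ℝ) * ((w k : ℝ) * r ^ k)

/-- `Ψ(r)` for real `r`. -/
noncomputable def realPsi (w : ℕ → ℝ≥0) (r : ℝ) : ℝ := realNum w r / realGen w r

theorem hasSum_realGen {r : ℝ} (hr : r ∈ convergenceInterval w) :
    HasSum (fun k : ℕ => (w k : ℝ) * r ^ k) (realGen w r) := (summable_weight hr).hasSum

theorem hasSum_realNum {r : ℝ} (hr : r ∈ convergenceInterval w) :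
    HasSum (fun k : ℕ => (k : ℝ) * ((w k : ℝ) * r ^ k)) (realNum w r) :=
  (summable_mul_weight hr).hasSum

theorem continuousOn_realGen : ContinuousOn (realGen w) (convergenceInterval w) := by
  unfold realGen
  simpa using continuousOn_tsum_pow_mul_weight (w := w) 0

theorem continuousOn_realNum : ContinuousOn (realNum w) (convergenceInterval w) := by
  unfold realNum
  simpa using continuousOn_tsum_pow_mul_weight (w := w) 1

theorem le_realGen {r : ℝ} (hr : r ∈ convergenceInterval w) : (w 0 : ℝ) ≤ realGen w r := by
  have hr0 := hr.1
  simpa [realGen] using (summable_weight hr).le_tsum 0 (fun k _ => by positivity)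

theorem realGen_pos (hw0 : 0 < w 0) {r : ℝ} (hr : r ∈ convergenceInterval w) :
    0 < realGen w r :=
  (NNReal.coe_pos.2 hw0).trans_le (le_realGen hr)

theorem realNum_pos (hw : ∃ k, 1 ≤ k ∧ 0 < w k) {r : ℝ} (hr : r ∈ convergenceInterval w)
    (hr0 : 0 < r) : 0 < realNum w r := by
  obtain ⟨k, hk, hwk⟩ := hw
  exact (summable_mul_weight hr).tsum_pos (fun k => by positivity) k (by positivity)

theorem realPsi_zero : realPsi w 0 = 0 := by
  have hterm : ∀ k : ℕ, (k : ℝ) * ((w k : ℝ) * 0 ^ k) = 0 := by rintro (_ | k) <;> simp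
  simp [realPsi, realNum, hterm]

theorem realPsi_nonneg {r : ℝ} (hr : 0 ≤ r) : 0 ≤ realPsi w r :=
  div_nonneg (tsum_nonneg fun _ => by positivity) (tsum_nonneg fun _ => by positivity)

theorem realPsi_pos (hw0 : 0 < w 0) (hw : ∃ k, 1 ≤ k ∧ 0 < w k) {r : ℝ}
    (hr : r ∈ convergenceInterval w) (hr0 : 0 < r) : 0 < realPsi w r :=
  div_pos (realNum_pos hw hr hr0) (realGen_pos hw0 hr)

theorem continuousOn_realPsi (hw0 : 0 < w 0) : ContinuousOn (realPsi w) (convergenceInterval w) :=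
  continuousOn_realNum.div continuousOn_realGen fun _ hr => (realGen_pos hw0 hr).ne'

theorem hasSum_sub_mul_weight {r : ℝ} (hr : r ∈ convergenceInterval w) (a : ℝ) :
    HasSum (fun k : ℕ => ((k : ℝ) - a) * ((w k : ℝ) * r ^ k)) (realNum w r - a * realGen w r) := by
  simp only [sub_mul]
  exact (hasSum_realNum hr).sub ((hasSum_realGen hr).mul_left a)

theorem realPsi_lt_of_pos (hw0 : 0 < w 0) (hw : ∃ k, 1 ≤ k ∧ 0 < w k) {s t : ℝ} (hs0 : 0 < s)
    (ht : t ∈ convergenceInterval w) (hst : s < t) : realPsi w s < realPsi w t := by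
  have hs := mem_convergenceInterval_of_le ht hs0.le hst.le
  have hq : 1 < t / s := (one_lt_div hs0).2 hst
  set a := realPsi w s with ha
  have ha0 : 0 < a := realPsi_pos hw0 hw hs hs0
  have hcentred : realNum w s - a * realGen w s = 0 := by
    rw [ha, realPsi, div_mul_cancel₀ _ (realGen_pos hw0 hs).ne', sub_self]
  -- Both factors of `(k - a) * ((t/s)^k - (t/s)^a)` have the same sign, and the weighted sum
  -- of `k - a` at `s` vanishes, so the one at `t` is positive.
  have hsum : HasSum (fun k : ℕ => ((w k : ℝ) * s ^ k) *
      (((t / s) ^ (k : ℝ) - (t / s) ^ a) * ((k : ℝ) - a))) (realNum w t - a * realGen w t) := by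
    have h := (hasSum_sub_mul_weight ht a).sub
      ((hasSum_sub_mul_weight hs a).mul_left ((t / s) ^ a))
    rw [hcentred, mul_zero, sub_zero] at h
    refine h.congr_fun fun k => ?_
    rw [Real.rpow_natCast, div_pow]
    field_simp
  have hsame : ∀ x : ℝ, 0 ≤ ((t / s) ^ x - (t / s) ^ a) * (x - a) := fun x =>
    ((Real.monotone_rpow_of_base_ge_one hq.le).monovary monotone_id).sub_mul_sub_nonneg a x
  have hpos : 0 < realNum w t - a * realGen w t := by
    rw [← hsum.tsum_eq]
    refine hsum.summable.tsum_pos (fun k => mul_nonneg (by positivity) (hsame k)) 0 ?_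
    have h1 : 1 < (t / s) ^ a := Real.one_lt_rpow hq ha0
    have hneg : (1 - (t / s) ^ a) * (0 - a) > 0 :=
      mul_pos_of_neg_of_neg (sub_neg.2 h1) (sub_neg.2 ha0)
    simpa using mul_pos (NNReal.coe_pos.2 hw0) hneg
  rw [realPsi, lt_div_iff₀ (realGen_pos hw0 ht)]
  linarith

theorem strictMonoOn_realPsi (hw0 : 0 < w 0) (hw : ∃ k, 1 ≤ k ∧ 0 < w k) :
    StrictMonoOn (realPsi w) (convergenceInterval w) := by
  intro s hs t ht hst
  rcases hs.1.eq_or_lt with rfl | hs0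
  · exact realPsi_zero.trans_lt (realPsi_pos hw0 hw ht hst)
  · exact realPsi_lt_of_pos hw0 hw hs0 ht hst

theorem Icc_realPsi_subset_image (hw0 : 0 < w 0) {r s : ℝ} (hr : 0 ≤ r)
    (hs : s ∈ convergenceInterval w) (hrs : r ≤ s) :
    Set.Icc (realPsi w r) (realPsi w s) ⊆ realPsi w '' Set.Icc r s :=
  intermediate_value_Icc hrs <| (continuousOn_realPsi hw0).mono fun _ hx =>
    mem_convergenceInterval_of_le hs (hr.trans hx.1) hx.2

theorem nhds_realPsi_le_map (hw0 : 0 < w 0) (hw : ∃ k, 1 ≤ k ∧ 0 < w k) {τ : ℝ}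
    (hτ : τ ∈ convergenceInterval w) (hτ0 : 0 < τ) :
    𝓝 (realPsi w τ) ≤ map (realPsi w) (𝓝 τ) := by
  intro U hU
  obtain ⟨a, b, haτ, hab, habU⟩ :=
    exists_Icc_mem_subset_of_mem_nhds (inter_mem (mem_map.1 hU) (inter_mem
      (convergenceInterval_mem_nhds hτ hτ0) (Ioi_mem_nhds hτ0)))
  have hle : a ≤ b := haτ.1.trans haτ.2
  have ha := habU (Set.left_mem_Icc.2 hle)
  have hb := habU (Set.right_mem_Icc.2 hle)
  have haτ' : a < τ := (Icc_mem_nhds_iff.1 hab).1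
  have hτb : τ < b := (Icc_mem_nhds_iff.1 hab).2
  filter_upwards [Icc_mem_nhds (strictMonoOn_realPsi hw0 hw ha.2.1 hτ haτ')
    (strictMonoOn_realPsi hw0 hw hτ hb.2.1 hτb)] with y hy
  obtain ⟨x, hx, rfl⟩ := Icc_realPsi_subset_image hw0 ha.2.1.1 hb.2.1 hle hy
  exact (habU hx).1

theorem genFun_ofReal {r : ℝ} (hr : r ∈ convergenceInterval w) :
    genFun w (ENNReal.ofReal r) = ENNReal.ofReal (realGen w r) := by
  have hr0 := hr.1
  rw [realGen, ENNReal.ofReal_tsum_of_nonneg (fun k => by positivity) (summable_weight hr)]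
  refine tsum_congr fun k => ?_
  rw [ENNReal.ofReal_mul (by positivity), ENNReal.ofReal_pow hr0, ENNReal.ofReal_coe_nnreal]

theorem psiQuot_ofReal (hw0 : 0 < w 0) {r : ℝ} (hr : r ∈ convergenceInterval w) :
    psiQuot w (ENNReal.ofReal r) = ENNReal.ofReal (realPsi w r) := by
  have hr0 := hr.1
  rw [psiQuot, genFun_ofReal hr, realPsi, ENNReal.ofReal_div_of_pos (realGen_pos hw0 hr),
    realNum, ENNReal.ofReal_tsum_of_nonneg (fun k => by positivity) (summable_mul_weight hr)]
  congr 1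
  refine tsum_congr fun k => ?_
  rw [ENNReal.ofReal_mul (by positivity), ENNReal.ofReal_mul (by positivity),
    ENNReal.ofReal_pow hr0, ENNReal.ofReal_coe_nnreal, ENNReal.ofReal_natCast, mul_assoc]

theorem Psi_ofReal (hw0 : 0 < w 0) {r : ℝ} (hr : r ∈ convergenceInterval w) :
    Psi w (ENNReal.ofReal r) = ENNReal.ofReal (realPsi w r) := by
  rw [Psi, if_pos (genFun_ofReal hr ▸ ENNReal.ofReal_lt_top), psiQuot_ofReal hw0 hr]

theorem monotoneOn_psiQuot (hw0 : 0 < w 0) (hw : ∃ k, 1 ≤ k ∧ 0 < w k) :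
    MonotoneOn (psiQuot w) (Set.Iio (rho w)) := by
  intro a ha b hb hab
  obtain ⟨s, hs, rfl⟩ := exists_ofReal_eq_of_lt_rho ha
  obtain ⟨t, ht, rfl⟩ := exists_ofReal_eq_of_lt_rho hb
  rw [psiQuot_ofReal hw0 hs, psiQuot_ofReal hw0 ht]
  exact ENNReal.ofReal_le_ofReal ((strictMonoOn_realPsi hw0 hw).monotoneOn hs ht
    ((ENNReal.ofReal_le_ofReal_iff ht.1).1 hab))

theorem genFun_mono {a b : ℝ≥0∞} (h : a ≤ b) : genFun w a ≤ genFun w b := by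
  unfold genFun; gcongr

theorem genFun_pos (hw0 : 0 < w 0) (t : ℝ≥0∞) : 0 < genFun w t :=
  (ENNReal.coe_pos.2 hw0).trans_le <| by
    simpa [genFun] using ENNReal.le_tsum (f := fun k : ℕ => (w k : ℝ≥0∞) * t ^ k) 0

theorem Psi_zero : Psi w 0 = 0 := by
  have hterm : ∀ k : ℕ, (k : ℝ≥0∞) * (w k : ℝ≥0∞) * 0 ^ k = 0 := by rintro (_ | k) <;> simp
  have hgen : genFun w 0 = w 0 := by
    rw [genFun, tsum_eq_single 0 (fun k hk => by simp [hk])]; simp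
  simp [Psi, psiQuot, hterm, hgen]

theorem rho_pos {a : ℝ≥0∞} (ha : a < nu w) : 0 < rho w :=
  pos_iff_ne_zero.2 fun h => by simp [nu, h, Psi_zero] at ha

theorem eventually_lt_psiQuot_nhdsLT (hw0 : 0 < w 0) {a t : ℝ≥0∞} (ht : genFun w t < ⊤)
    (ha : a < psiQuot w t) : ∀ᶠ s in 𝓝[<] t, a < psiQuot w s := by
  have hlt : ∀ {s : ℝ≥0∞}, genFun w s < ⊤ → (a < psiQuot w s ↔
      a * genFun w s < ∑' k : ℕ, (k : ℝ≥0∞) * (w k : ℝ≥0∞) * s ^ k) := fun {s} hs =>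
    ENNReal.lt_div_iff_mul_lt (Or.inl (genFun_pos hw0 s).ne') (Or.inl hs.ne)
  have hlsc : LowerSemicontinuous fun s : ℝ≥0∞ => ∑' k : ℕ, (k : ℝ≥0∞) * (w k : ℝ≥0∞) * s ^ k :=
    lowerSemicontinuous_tsum fun k => ((ENNReal.continuous_const_mul (ENNReal.mul_ne_top
      (ENNReal.natCast_ne_top k) ENNReal.coe_ne_top)).comp
        (ENNReal.continuous_pow k)).lowerSemicontinuous
  filter_upwards [nhdsWithin_le_nhds (hlsc t _ ((hlt ht).1 ha)), self_mem_nhdsWithin] with s hs hst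
  have hgen : genFun w s ≤ genFun w t := genFun_mono (le_of_lt hst)
  exact (hlt (hgen.trans_lt ht)).2 (lt_of_le_of_lt (by gcongr) hs)

theorem exists_lt_psiQuot (hw0 : 0 < w 0) (hw : ∃ k, 1 ≤ k ∧ 0 < w k) {a : ℝ≥0∞}
    (ha : a < nu w) : ∃ s < rho w, a < psiQuot w s := by
  have hne : (𝓝[<] (rho w)).NeBot := nhdsLT_neBot_of_exists_lt ⟨0, rho_pos ha⟩
  rw [nu, Psi] at ha
  split_ifs at ha with hfin
  · exact (eventually_mem_nhdsWithin.and (eventually_lt_psiQuot_nhdsLT hw0 hfin ha)).exists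
  · rw [((monotoneOn_psiQuot hw0 hw).tendsto_nhdsLT (OrderTop.bddAbove _)).limUnder_eq,
      lt_sSup_iff] at ha
    obtain ⟨_, ⟨s, hs, rfl⟩, hlt⟩ := ha
    exact ⟨s, hs, hlt⟩

theorem exists_realPsi_eq (hw0 : 0 < w 0) (hw : ∃ k, 1 ≤ k ∧ 0 < w k) {lam : ℝ} (hlam : 0 < lam)
    (hnu : ENNReal.ofReal lam < nu w) :
    ∃ τ ∈ convergenceInterval w, 0 < τ ∧ realPsi w τ = lam := by
  obtain ⟨s, hsρ, hlt⟩ := exists_lt_psiQuot hw0 hw hnu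
  obtain ⟨r, hr, rfl⟩ := exists_ofReal_eq_of_lt_rho hsρ
  rw [psiQuot_ofReal hw0 hr, ENNReal.ofReal_lt_ofReal_iff_of_nonneg hlam.le] at hlt
  obtain ⟨τ, hτr, hτ⟩ : lam ∈ realPsi w '' Set.Icc 0 r :=
    Icc_realPsi_subset_image hw0 le_rfl hr hr.1 ⟨realPsi_zero.trans_le hlam.le, hlt.le⟩
  refine ⟨τ, mem_convergenceInterval_of_le hr hτr.1 hτr.2, hτr.1.lt_of_ne ?_, hτ⟩
  rintro rfl
  exact hlam.ne (realPsi_zero.symm.trans hτ)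

theorem eq_ofReal_of_Psi_eq (hw0 : 0 < w 0) (hw : ∃ k, 1 ≤ k ∧ 0 < w k) {τ : ℝ}
    (hτ : τ ∈ convergenceInterval w) (hnu : ENNReal.ofReal (realPsi w τ) < nu w)
    {s : ℝ≥0∞} (hs : s ≤ rho w) (h : Psi w s = ENNReal.ofReal (realPsi w τ)) :
    s = ENNReal.ofReal τ := by
  rcases hs.eq_or_lt with rfl | hs
  · exact absurd h hnu.ne'
  obtain ⟨t, ht, rfl⟩ := exists_ofReal_eq_of_lt_rho hs
  rw [Psi_ofReal hw0 ht, ENNReal.ofReal_eq_ofReal_iff (realPsi_nonneg ht.1)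
    (realPsi_nonneg hτ.1)] at h
  rw [(strictMonoOn_realPsi hw0 hw).injOn ht hτ h]

theorem exists_tendsto_of_nhds_le_map {ι α β : Type*} [TopologicalSpace α] [TopologicalSpace β]
    {f : α → β} {s : Set α} {a : α} (hf : Set.InjOn f s) (hs : s ∈ 𝓝 a)
    (hfa : 𝓝 (f a) ≤ map f (𝓝 a)) {l : Filter ι} {x : ι → β} (hx : Tendsto x l (𝓝 (f a))) :
    ∃ g : ι → α, Tendsto g l (𝓝 a) ∧ ∀ᶠ i in l, f (g i) = x i := by
  have : Nonempty α := ⟨a⟩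
  have hinv : ∀ᶠ y in 𝓝 a, Function.invFunOn f s (f y) = y :=
    eventually_of_mem hs hf.leftInvOn_invFunOn
  have hx' : Tendsto x l (map f (𝓝 a)) := hx.mono_right hfa
  refine ⟨Function.invFunOn f s ∘ x, Tendsto.comp ?_ hx',
    hx'.eventually (p := fun y => f (Function.invFunOn f s y) = y) ?_⟩
  · exact tendsto_map'_iff.2 (tendsto_id.congr' (hinv.mono fun _ h => h.symm))
  · exact eventually_map.2 (hinv.mono fun _ h => congrArg f h)

theorem exists_tendsto_realPsi_eq (hw0 : 0 < w 0) (hw : ∃ k, 1 ≤ k ∧ 0 < w k) {τ : ℝ}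
    (hτ : τ ∈ convergenceInterval w) (hτ0 : 0 < τ) {ι : Type*} {l : Filter ι} {x : ι → ℝ}
    (hx : Tendsto x l (𝓝 (realPsi w τ))) :
    ∃ T : ι → ℝ, Tendsto T l (𝓝 τ) ∧ ∀ᶠ i in l, realPsi w (T i) = x i :=
  exists_tendsto_of_nhds_le_map (strictMonoOn_realPsi hw0 hw).injOn
    (convergenceInterval_mem_nhds hτ hτ0) (nhds_realPsi_le_map hw0 hw hτ hτ0) hx

end PowerSeries

/-! ### Convolutions of sequences and Fourier inversion -/

section CauchyProduct

variable {ι R : Type*} [DecidableEq ι]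

theorem sum_piAntidiag_cons_prod [CommSemiring R] (f : ι → ℕ → R) {i : ι} {s : Finset ι}
    (hi : i ∉ s) (m : ℕ) :
    ∑ y ∈ (Finset.cons i s hi).piAntidiag m, ∏ j ∈ Finset.cons i s hi, f j (y j) =
      ∑ kl ∈ Finset.HasAntidiagonal.antidiagonal m,
        f i kl.1 * ∑ y ∈ s.piAntidiag kl.2, ∏ j ∈ s, f j (y j) := by
  rw [Finset.piAntidiag_cons, Finset.sum_disjiUnion]
  refine Finset.sum_congr rfl fun kl _ => ?_
  rw [Finset.sum_map, Finset.mul_sum]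
  refine Finset.sum_congr rfl fun y hy => ?_
  have hyi : y i = 0 := by
    by_contra h
    exact hi ((Finset.mem_piAntidiag.1 hy).2 i h)
  rw [Finset.prod_cons]
  congr 1
  · simp [hyi]
  · refine Finset.prod_congr rfl fun j hj => ?_
    simp [ne_of_mem_of_not_mem hj hi]

variable [NormedCommRing R]

theorem summable_norm_sum_piAntidiag_prod {f : ι → ℕ → R} {s : Finset ι}
    (hf : ∀ i ∈ s, Summable fun k => ‖f i k‖) :
    Summable fun m => ‖∑ y ∈ s.piAntidiag m, ∏ i ∈ s, f i (y i)‖ := by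
  induction s using Finset.cons_induction with
  | empty =>
    refine summable_of_ne_finset_zero (s := {0}) fun m hm => ?_
    simp [Finset.notMem_singleton.1 hm]
  | cons i s hi ih =>
    rw [Finset.forall_mem_cons] at hf
    simp only [sum_piAntidiag_cons_prod]
    exact summable_norm_sum_mul_antidiagonal_of_summable_norm (f := f i)
      (g := fun l => ∑ y ∈ s.piAntidiag l, ∏ j ∈ s, f j (y j)) hf.1 (ih hf.2)

theorem prod_tsum_eq_tsum_sum_piAntidiag [CompleteSpace R] {f : ι → ℕ → R} {s : Finset ι}
    (hf : ∀ i ∈ s, Summable fun k => ‖f i k‖) :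
    ∏ i ∈ s, ∑' k, f i k = ∑' m, ∑ y ∈ s.piAntidiag m, ∏ i ∈ s, f i (y i) := by
  induction s using Finset.cons_induction with
  | empty =>
    rw [tsum_eq_single 0 fun m hm => by simp [hm]]
    simp
  | cons i s hi ih =>
    rw [Finset.forall_mem_cons] at hf
    simp only [sum_piAntidiag_cons_prod]
    rw [Finset.prod_cons, ih hf.2, tsum_mul_tsum_eq_tsum_sum_antidiagonal_of_summable_norm hf.1
      (summable_norm_sum_piAntidiag_prod hf.2)]

end CauchyProduct

/-- The characteristic function `∑ u_k e^{ikt}` of a summable sequence `u`. -/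
noncomputable def charSum (u : ℕ → ℝ) (t : ℝ) : ℂ :=
  ∑' k : ℕ, (u k : ℂ) * Complex.exp (((k : ℝ) * t : ℝ) * Complex.I)

theorem norm_ofReal_mul_exp_ofReal_mul_I (a x : ℝ) :
    ‖(a : ℂ) * Complex.exp ((x : ℝ) * Complex.I)‖ = |a| := by
  rw [norm_mul, Complex.norm_exp_ofReal_mul_I, mul_one, Complex.norm_real, Real.norm_eq_abs]

section CharSum

variable {u : ℕ → ℝ}

theorem summable_norm_charSum (hu : Summable u) (t : ℝ) :
    Summable fun k : ℕ => ‖(u k : ℂ) * Complex.exp (((k : ℝ) * t : ℝ) * Complex.I)‖ := by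
  simpa only [norm_ofReal_mul_exp_ofReal_mul_I] using hu.abs

theorem norm_charSum_le (hu : Summable u) (h0 : ∀ k, 0 ≤ u k) (t : ℝ) :
    ‖charSum u t‖ ≤ ∑' k, u k :=
  tsum_of_norm_bounded hu.hasSum fun k => by
    rw [norm_ofReal_mul_exp_ofReal_mul_I, abs_of_nonneg (h0 k)]

theorem continuous_charSum (hu : Summable u) : Continuous (charSum u) :=
  continuous_tsum (fun k => by fun_prop) hu.abs
    fun k t => (norm_ofReal_mul_exp_ofReal_mul_I _ _).le

theorem integral_exp_int_mul {d : ℕ} (hd : 0 < d) (j : ℤ) :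
    ∫ t in -(π / d)..(π / d), Complex.exp (((j * d : ℝ) * t : ℝ) * Complex.I) =
      if j = 0 then ((2 * π / d : ℝ) : ℂ) else 0 := by
  split_ifs with hj
  · simp only [hj, Int.cast_zero, zero_mul, Complex.ofReal_zero, Complex.exp_zero]
    rw [intervalIntegral.integral_const, Complex.real_smul, mul_one]
    ring_nf
  · have hd0 : (d : ℂ) ≠ 0 := by exact_mod_cast hd.ne'
    have hc : (j * d : ℂ) * Complex.I ≠ 0 :=
      mul_ne_zero (mul_ne_zero (by exact_mod_cast hj) hd0) Complex.I_ne_zero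
    have hexp : ∀ t : ℝ, Complex.exp (((j * d : ℝ) * t : ℝ) * Complex.I) =
        Complex.exp ((j * d : ℂ) * Complex.I * t) := fun t => by
      congr 1; push_cast; ring
    have hperiod : (j * d : ℂ) * Complex.I * ((π / d : ℝ) : ℂ) =
        (j * d : ℂ) * Complex.I * ((-(π / d) : ℝ) : ℂ) + j * (2 * π * Complex.I) := by
      push_cast; field_simp; ring
    simp only [hexp]
    rw [integral_exp_mul_complex hc, hperiod, Complex.exp_add,
      Complex.exp_int_mul_two_pi_mul_I, mul_one, sub_self, zero_div]

theorem integral_charSum_mul_exp {d m : ℕ} (hd : 0 < d) (hu : Summable u)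
    (hud : ∀ k, u k ≠ 0 → d ∣ k) (hdm : d ∣ m) :
    ∫ t in -(π / d)..(π / d), charSum u t * Complex.exp ((-(m * t) : ℝ) * Complex.I) =
      (2 * π / d : ℝ) * (u m : ℂ) := by
  have hterm : ∀ k, ∫ t in -(π / d)..(π / d),
      (u k : ℂ) * Complex.exp (((k : ℝ) * t : ℝ) * Complex.I) *
        Complex.exp ((-(m * t) : ℝ) * Complex.I) =
      if k = m then (2 * π / d : ℝ) * (u m : ℂ) else 0 := by
    intro k
    by_cases hk : u k = 0
    · by_cases hkm : k = m <;> simp_all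
    obtain ⟨a, rfl⟩ := hud k hk
    obtain ⟨b, rfl⟩ := hdm
    have hexp : ∀ t : ℝ, Complex.exp ((((d * a : ℕ) : ℝ) * t : ℝ) * Complex.I) *
        Complex.exp ((-(((d * b : ℕ) : ℝ) * t) : ℝ) * Complex.I) =
        Complex.exp (((((a : ℤ) - b : ℤ) : ℝ) * d * t : ℝ) * Complex.I) := fun t => by
      rw [← Complex.exp_add]; congr 1; push_cast; ring
    have hab : ((a : ℤ) - b = 0) ↔ d * a = d * b := by
      rw [Nat.mul_right_inj hd.ne']; lia
    simp only [mul_assoc (u (d * a) : ℂ), hexp, intervalIntegral.integral_const_mul,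
      integral_exp_int_mul hd, hab]
    split_ifs with h
    · rw [h, mul_comm]
    · rw [mul_zero]
  have hsum := intervalIntegral.hasSum_integral_of_dominated_convergence
    (μ := volume) (a := -(π / d)) (b := π / d) (f := fun t : ℝ =>
      charSum u t * Complex.exp ((-(m * t) : ℝ) * Complex.I))
    (F := fun (k : ℕ) (t : ℝ) => (u k : ℂ) * Complex.exp (((k : ℝ) * t : ℝ) * Complex.I) *
      Complex.exp ((-(m * t) : ℝ) * Complex.I)) (fun k _ => |u k|)
    (fun k => Continuous.aestronglyMeasurable (by fun_prop))
    (fun k => .of_forall fun t _ => by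
      rw [norm_mul, norm_ofReal_mul_exp_ofReal_mul_I, Complex.norm_exp_ofReal_mul_I, mul_one])
    (.of_forall fun _ _ => hu.abs) intervalIntegrable_const
    (.of_forall fun t _ => (summable_norm_charSum hu t).of_norm.hasSum.mul_right _)
  simp only [hterm] at hsum
  exact hsum.unique (hasSum_ite_eq m _)

end CharSum

section Convolution

variable {ι : Type*} [Fintype ι] [DecidableEq ι] {u : ι → ℕ → ℝ}

/-- The convolution of finitely many sequences. If each `u i` is the law of a random variable, then
`convolution u` is the law of the sum of independent such variables. -/
def convolution (u : ι → ℕ → ℝ) (m : ℕ) : ℝ :=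
  ∑ y ∈ Finset.univ.piAntidiag m, ∏ i, u i (y i)

theorem summable_convolution (hu : ∀ i, Summable (u i)) : Summable (convolution u) := by
  have h := summable_norm_sum_piAntidiag_prod (f := u) (s := Finset.univ) fun i _ => (hu i).norm
  exact h.of_norm

theorem dvd_of_convolution_ne_zero {d : ℕ} (hud : ∀ i k, u i k ≠ 0 → d ∣ k) {m : ℕ}
    (hm : convolution u m ≠ 0) : d ∣ m := by
  obtain ⟨y, hy, hne⟩ := Finset.exists_ne_zero_of_sum_ne_zero hm
  rw [← (Finset.mem_piAntidiag.1 hy).1]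
  exact Finset.dvd_sum fun i _ => hud i (y i) (Finset.prod_ne_zero_iff.1 hne i (Finset.mem_univ i))

theorem charSum_convolution (hu : ∀ i, Summable (u i)) (t : ℝ) :
    charSum (convolution u) t = ∏ i, charSum (u i) t := by
  simp only [charSum]
  rw [prod_tsum_eq_tsum_sum_piAntidiag fun i _ => summable_norm_charSum (hu i) t]
  refine tsum_congr fun m => ?_
  rw [convolution, Complex.ofReal_sum, Finset.sum_mul]
  refine Finset.sum_congr rfl fun y hy => ?_
  rw [Finset.prod_mul_distrib, ← Complex.exp_sum, ← Finset.sum_mul, Complex.ofReal_prod,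
    ← (Finset.mem_piAntidiag.1 hy).1]
  push_cast
  rw [Finset.sum_mul]

theorem integral_prod_charSum_mul_exp {d m : ℕ} (hd : 0 < d) (hu : ∀ i, Summable (u i))
    (hud : ∀ i k, u i k ≠ 0 → d ∣ k) (hdm : d ∣ m) :
    ∫ t in -(π / d)..(π / d), (∏ i, charSum (u i) t) *
      Complex.exp ((-(m * t) : ℝ) * Complex.I) = (2 * π / d : ℝ) * (convolution u m : ℂ) := by
  simp only [← charSum_convolution hu]
  exact integral_charSum_mul_exp hd (summable_convolution hu)
    (fun k hk => dvd_of_convolution_ne_zero hud hk) hdm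

end Convolution

/-! ### Gaussian bounds for characteristic functions -/

theorem norm_add_mul_exp_le {a b θ : ℝ} (ha : 0 ≤ a) (hb : 0 ≤ b) (hab : a + b ≤ 1) :
    ‖(a : ℂ) + b * Complex.exp ((θ : ℝ) * Complex.I)‖ ≤ a + b - a * b * (1 - Real.cos θ) := by
  have hcos : 0 ≤ a * b * (1 - Real.cos θ) :=
    mul_nonneg (mul_nonneg ha hb) (sub_nonneg.2 (Real.cos_le_one θ))
  have hnonneg : 0 ≤ a + b - a * b * (1 - Real.cos θ) := by
    nlinarith [sq_nonneg (a - b), Real.neg_one_le_cos θ, mul_nonneg ha hb]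
  have hsq : ‖(a : ℂ) + b * Complex.exp ((θ : ℝ) * Complex.I)‖ ^ 2
      = (a + b) ^ 2 - 2 * (a * b) * (1 - Real.cos θ) := by
    rw [Complex.sq_norm, Complex.normSq_apply]
    simp only [Complex.add_re, Complex.ofReal_re, Complex.re_ofReal_mul,
      Complex.exp_ofReal_mul_I_re, Complex.add_im, Complex.ofReal_im, Complex.im_ofReal_mul,
      Complex.exp_ofReal_mul_I_im]
    linear_combination b ^ 2 * Real.sin_sq_add_cos_sq θ
  refine le_of_sq_le_sq ?_ hnonneg
  rw [hsq]
  nlinarith [sq_nonneg (a * b * (1 - Real.cos θ))]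

theorem norm_charSum_le_one_sub {p : ℕ → ℝ} (hs : HasSum p 1) (h0 : ∀ k, 0 ≤ p k) (k : ℕ)
    (t : ℝ) : ‖charSum p t‖ ≤ 1 - p 0 * p k * (1 - Real.cos (k * t)) := by
  rcases eq_or_ne 0 k with rfl | hk
  · simpa [hs.tsum_eq] using norm_charSum_le hs.summable h0 t
  let s : Finset ℕ := {0, k}
  have hsplit := (summable_norm_charSum hs.summable t).of_norm.sum_add_tsum_compl (s := s)
  have hmass := hs.summable.sum_add_tsum_compl (s := s)
  rw [Finset.sum_pair hk] at hsplit hmass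
  rw [hs.tsum_eq] at hmass
  have hrest : ‖∑' x : ((s : Set ℕ)ᶜ : Set ℕ),
      (p x : ℂ) * Complex.exp ((((x : ℕ) : ℝ) * t : ℝ) * Complex.I)‖
      ≤ ∑' x : ((s : Set ℕ)ᶜ : Set ℕ), p x :=
    tsum_of_norm_bounded (hs.summable.subtype _).hasSum fun x => by
      rw [norm_ofReal_mul_exp_ofReal_mul_I, abs_of_nonneg (h0 _), Function.comp_apply]
  have hrest0 : 0 ≤ ∑' x : ((s : Set ℕ)ᶜ : Set ℕ), p x := tsum_nonneg fun x => h0 _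
  have hpair := norm_add_mul_exp_le (θ := k * t) (h0 0) (h0 k) (by linarith)
  rw [charSum, ← hsplit]
  refine (norm_add_le _ _).trans ?_
  simp only [Nat.cast_zero, zero_mul, Complex.ofReal_zero, Complex.exp_zero, mul_one]
  linarith

theorem exists_finset_gcd_dvd {α : Type*} [CommMonoidWithZero α] [NormalizedGCDMonoid α]
    [WfDvdMonoid α] (S : Set α) :
    ∃ F : Finset α, ↑F ⊆ S ∧ ∀ k ∈ S, F.gcd id ∣ k := by
  classical
  obtain ⟨_, ⟨F, hFS, rfl⟩, hmin⟩ := WellFounded.has_min wellFounded_dvdNotUnit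
    {d : α | ∃ F : Finset α, ↑F ⊆ S ∧ F.gcd id = d} ⟨_, ∅, by simp, rfl⟩
  refine ⟨F, hFS, fun k hk => ?_⟩
  by_contra hdk
  refine hmin ((insert k F).gcd id) ⟨insert k F, ?_, rfl⟩
    (dvdNotUnit_of_dvd_of_not_dvd (Finset.gcd_mono (Finset.subset_insert k F)) fun h => ?_)
  · rw [Finset.coe_insert]
    exact Set.insert_subset hk hFS
  · exact hdk (h.trans (Finset.gcd_dvd (f := id) (Finset.mem_insert_self k F)))

theorem exp_mul_I_eq_one_of_cos_eq_one {x : ℝ} (hx : Real.cos x = 1) :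
    Complex.exp (x * Complex.I) = 1 := by
  obtain ⟨n, rfl⟩ := (Real.cos_eq_one_iff x).1 hx
  refine Complex.exp_eq_one_iff.2 ⟨n, ?_⟩
  push_cast
  ring

theorem eq_zero_of_cos_eq_one {F : Finset ℕ} (hF : F.gcd id ≠ 0) {t : ℝ}
    (ht : |t| ≤ π / F.gcd id) (h : ∀ k ∈ F, Real.cos (k * t) = 1) : t = 0 := by
  set d := F.gcd id
  have hd0 : (0 : ℝ) < d := by exact_mod_cast Nat.pos_of_ne_zero hF
  have hpow : ∀ k : ℕ, Complex.exp ((t : ℝ) * Complex.I) ^ k =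
      Complex.exp (((k * t : ℝ) : ℂ) * Complex.I) := fun k => by
    rw [← Complex.exp_nat_mul]; congr 1; push_cast; ring
  have horder : orderOf (Complex.exp ((t : ℝ) * Complex.I)) ∣ d :=
    Finset.dvd_gcd fun k hk => orderOf_dvd_of_pow_eq_one <|
      (hpow k).trans (exp_mul_I_eq_one_of_cos_eq_one (h k hk))
  have hcos : Real.cos (d * t) = 1 := by
    have hone := (hpow d).symm.trans (orderOf_dvd_iff_pow_eq_one.1 horder)
    have hre := congrArg Complex.re hone
    rwa [Complex.exp_ofReal_mul_I_re, Complex.one_re] at hre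
  have hdt : |(d : ℝ) * t| ≤ π := by
    rwa [abs_mul, abs_of_pos hd0, mul_comm, ← le_div_iff₀ hd0]
  have hzero := (Real.cos_eq_one_iff_of_lt_of_lt (by linarith [(abs_le.1 hdt).1, Real.pi_pos])
    (by linarith [(abs_le.1 hdt).2, Real.pi_pos])).1 hcos
  exact (mul_eq_zero.1 hzero).resolve_left hd0.ne'

theorem one_sub_cos_eq_sq_mul_sinc_sq (a t : ℝ) :
    1 - Real.cos (a * t) = t ^ 2 * (a ^ 2 / 2 * Real.sinc (a * t / 2) ^ 2) := by
  rcases eq_or_ne (a * t / 2) 0 with h | h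
  · have hat : a * t = 0 := by linarith
    rcases mul_eq_zero.1 hat with rfl | rfl <;> simp
  · have hat : a * t ≠ 0 := fun hzero => h (by rw [hzero, zero_div])
    have hdouble := Real.sin_sq_eq_half_sub (a * t / 2)
    rw [mul_div_cancel₀ _ two_ne_zero] at hdouble
    rw [Real.sinc_of_ne_zero h, div_pow, hdouble]
    have ha := left_ne_zero_of_mul hat
    have ht := right_ne_zero_of_mul hat
    field_simp

theorem exists_sq_le_sum_one_sub_cos {F : Finset ℕ} (hF : F.gcd id ≠ 0) :
    ∃ c > 0, ∀ t : ℝ, |t| ≤ π / F.gcd id → c * t ^ 2 ≤ ∑ k ∈ F, (1 - Real.cos (k * t)) := by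
  let h : ℝ → ℝ := fun t => ∑ k ∈ F, (k : ℝ) ^ 2 / 2 * Real.sinc (k * t / 2) ^ 2
  have hsum : ∀ t, ∑ k ∈ F, (1 - Real.cos (k * t)) = t ^ 2 * h t := fun t => by
    simp only [h, one_sub_cos_eq_sq_mul_sinc_sq, Finset.mul_sum]
  have hcont : Continuous h := by
    have := Real.continuous_sinc
    fun_prop
  have hpos : ∀ t : ℝ, |t| ≤ π / F.gcd id → 0 < h t := by
    intro t ht
    refine (Finset.sum_nonneg fun k _ => by positivity : 0 ≤ h t).lt_of_ne' fun hzero => ?_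
    have hcos : ∀ k ∈ F, Real.cos (k * t) = 1 := fun k hk => by
      have hz := (hsum t).trans (congrArg (t ^ 2 * ·) hzero)
      rw [mul_zero, Finset.sum_eq_zero_iff_of_nonneg fun k _ =>
        sub_nonneg.2 (Real.cos_le_one _)] at hz
      exact (sub_eq_zero.1 (hz k hk)).symm
    obtain rfl := eq_zero_of_cos_eq_one hF ht hcos
    refine hF (Finset.gcd_eq_zero_iff.2 fun k hk => ?_)
    simpa [h, Finset.sum_eq_zero_iff_of_nonneg fun (k : ℕ) _ => sq_nonneg (k : ℝ)]
      using (Finset.sum_eq_zero_iff_of_nonneg fun k _ => by positivity).1 hzero k hk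
  obtain ⟨t₀, ht₀, hmin⟩ :=
    (isCompact_Icc (a := -(π / F.gcd id)) (b := π / F.gcd id)).exists_isMinOn
      ⟨0, by simp only [Set.mem_Icc, Left.neg_nonpos_iff, and_self]; positivity⟩
      hcont.continuousOn
  refine ⟨h t₀, hpos t₀ (abs_le.2 ht₀), fun t ht => ?_⟩
  rw [hsum, mul_comm]
  gcongr
  exact hmin (abs_le.1 ht)

theorem exists_norm_charSum_le_exp {F : Finset ℕ} (hF : F.gcd id ≠ 0) {a : ℝ} (ha : 0 < a) :
    ∃ c > 0, ∀ p : ℕ → ℝ, HasSum p 1 → (∀ k, 0 ≤ p k) → (∀ k ∈ F, a ≤ p 0 * p k) →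
      ∀ t : ℝ, |t| ≤ π / F.gcd id → ‖charSum p t‖ ≤ Real.exp (-c * t ^ 2) := by
  obtain ⟨c, hc, hcF⟩ := exists_sq_le_sum_one_sub_cos hF
  have hcard : (0 : ℝ) < F.card := by
    have : F.Nonempty := Finset.nonempty_of_ne_empty fun h => hF (by simp [h])
    exact_mod_cast this.card_pos
  refine ⟨a * c / F.card, by positivity, fun p hs h0 hap t ht => ?_⟩
  have hone : ∀ k ∈ F, a * (1 - Real.cos (k * t)) ≤ 1 - ‖charSum p t‖ := fun k hk => by
    have hnorm := norm_charSum_le_one_sub hs h0 k t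
    have hcos := mul_le_mul_of_nonneg_right (hap k hk) (sub_nonneg.2 (Real.cos_le_one (k * t)))
    linarith
  have hall : a * (c * t ^ 2) ≤ F.card * (1 - ‖charSum p t‖) := by
    calc a * (c * t ^ 2) ≤ a * ∑ k ∈ F, (1 - Real.cos (k * t)) := by gcongr; exact hcF t ht
      _ ≤ F.card * (1 - ‖charSum p t‖) := by
        rw [Finset.mul_sum, ← nsmul_eq_mul]
        exact Finset.sum_le_card_nsmul _ _ _ hone
  have hle : a * c / F.card * t ^ 2 ≤ 1 - ‖charSum p t‖ := by
    rw [div_mul_eq_mul_div, div_le_iff₀ hcard]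
    linarith
  linarith [Real.add_one_le_exp (-(a * c / F.card) * t ^ 2)]

/-! ### The upper bound for local probabilities -/

section UpperBound

variable {ι : Type*} [DecidableEq ι] {p : ℕ → ℝ}

theorem summable_piecewise_indicator (hp : Summable p) (B : Finset ι) (A : Set ℕ) (i : ι) :
    Summable (B.piecewise (fun _ => A.indicator p) (fun _ => p) i) := by
  by_cases hi : i ∈ B
  · simpa [hi] using hp.indicator A
  · simpa [hi] using hp

theorem dvd_of_piecewise_indicator_ne_zero {d : ℕ} (hpd : ∀ k, p k ≠ 0 → d ∣ k) (B : Finset ι)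
    (A : Set ℕ) (i : ι) (k : ℕ)
    (hk : B.piecewise (fun _ => A.indicator p) (fun _ => p) i k ≠ 0) : d ∣ k := by
  by_cases hi : i ∈ B
  · rw [Finset.piecewise_eq_of_mem _ _ _ hi] at hk
    exact hpd k (Set.indicator_apply_ne_zero.1 hk).2
  · rw [Finset.piecewise_eq_of_notMem _ _ _ hi] at hk
    exact hpd k hk

variable [Fintype ι]

theorem convolution_le_of_norm_prod_charSum_le {u : ι → ℕ → ℝ} {d m : ℕ} (hd : 0 < d)
    (hu : ∀ i, Summable (u i)) (hud : ∀ i k, u i k ≠ 0 → d ∣ k) (hdm : d ∣ m) {K b : ℝ}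
    (hb : 0 < b)
    (hK : ∀ t : ℝ, |t| ≤ π / d → ∏ i, ‖charSum (u i) t‖ ≤ K * Real.exp (-b * t ^ 2)) :
    convolution u m ≤ d / (2 * π) * (K * √(π / b)) := by
  have : (0 : ℝ) < d := by exact_mod_cast hd
  have hK0 : 0 ≤ K := by
    have h0 : |(0 : ℝ)| ≤ π / d := by rw [abs_zero]; positivity
    simpa using (Finset.prod_nonneg fun i _ => norm_nonneg _).trans (hK 0 h0)
  have hint : Integrable fun t : ℝ => K * Real.exp (-b * t ^ 2) :=
    (integrable_exp_neg_mul_sq hb).const_mul _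
  have hnorm : ‖∫ t in -(π / d)..(π / d), (∏ i, charSum (u i) t) *
      Complex.exp ((-(m * t) : ℝ) * Complex.I)‖ ≤ K * √(π / b) := by
    rw [intervalIntegral.integral_of_le (neg_le_self (by positivity))]
    calc _ ≤ ∫ t in Set.Ioc (-(π / d)) (π / d), K * Real.exp (-b * t ^ 2) := by
          refine norm_integral_le_of_norm_le hint.integrableOn
            ((ae_restrict_iff' measurableSet_Ioc).2 (.of_forall fun t ht => ?_))
          rw [norm_mul, Complex.norm_exp_ofReal_mul_I, mul_one, norm_prod]
          exact hK t (abs_le.2 ⟨ht.1.le, ht.2⟩)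
      _ ≤ ∫ t : ℝ, K * Real.exp (-b * t ^ 2) :=
          setIntegral_le_integral hint (.of_forall fun t => by positivity)
      _ = K * √(π / b) := by rw [integral_const_mul, integral_gaussian]
  rw [integral_prod_charSum_mul_exp hd hu hud hdm, norm_mul, Complex.norm_real,
    Complex.norm_real, Real.norm_of_nonneg (by positivity), Real.norm_eq_abs] at hnorm
  calc convolution u m = d / (2 * π) * (2 * π / d * convolution u m) := by field_simp
    _ ≤ d / (2 * π) * (K * √(π / b)) := by
      refine mul_le_mul_of_nonneg_left ?_ (by positivity)
      exact (mul_le_mul_of_nonneg_left (le_abs_self _) (by positivity)).trans hnorm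

theorem prod_norm_charSum_piecewise_indicator_le (hp : Summable p) (h0 : ∀ k, 0 ≤ p k)
    {b t : ℝ} (hb : 0 ≤ b) (hφ : ‖charSum p t‖ ≤ Real.exp (-b * t ^ 2)) {B : Finset ι}
    (hB : 2 * B.card ≤ Fintype.card ι) (A : Set ℕ) :
    ∏ i, ‖charSum (B.piecewise (fun _ => A.indicator p) (fun _ => p) i) t‖ ≤
      (∑' k, A.indicator p k) ^ B.card * Real.exp (-(b * Fintype.card ι / 2) * t ^ 2) := by
  have hA0 : ∀ k, 0 ≤ A.indicator p k := fun k => Set.indicator_nonneg (fun k _ => h0 k) k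
  have hrest : (Fintype.card ι : ℝ) / 2 ≤ (Bᶜ.card : ℕ) := by
    have hcard : (B.card : ℝ) + Bᶜ.card = Fintype.card ι := by
      exact_mod_cast B.card_add_card_compl
    have hB' : (2 : ℝ) * B.card ≤ Fintype.card ι := by exact_mod_cast hB
    linarith
  rw [← Finset.prod_mul_prod_compl B]
  refine mul_le_mul ?_ ?_ (Finset.prod_nonneg fun i _ => norm_nonneg _)
    (pow_nonneg (tsum_nonneg hA0) _)
  · rw [← Finset.prod_const]
    refine Finset.prod_le_prod (fun i _ => norm_nonneg _) fun i hi => ?_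
    rw [Finset.piecewise_eq_of_mem _ _ _ hi]
    exact norm_charSum_le (hp.indicator A) hA0 t
  · calc _ ≤ ∏ i ∈ Bᶜ, Real.exp (-b * t ^ 2) := by
          refine Finset.prod_le_prod (fun i _ => norm_nonneg _) fun i hi => ?_
          rwa [Finset.piecewise_eq_of_notMem _ _ _ (Finset.mem_compl.1 hi)]
      _ = Real.exp (-(b * Bᶜ.card) * t ^ 2) := by
          rw [Finset.prod_const, ← Real.exp_nat_mul]
          ring_nf
      _ ≤ Real.exp (-(b * Fintype.card ι / 2) * t ^ 2) := by
          gcongr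
          rw [mul_div_assoc]
          gcongr

theorem convolution_piecewise_indicator_le (hp : Summable p) (h0 : ∀ k, 0 ≤ p k)
    {d m : ℕ} (hd : 0 < d) (hpd : ∀ k, p k ≠ 0 → d ∣ k) (hdm : d ∣ m) {b : ℝ} (hb : 0 < b)
    (hφ : ∀ t : ℝ, |t| ≤ π / d → ‖charSum p t‖ ≤ Real.exp (-b * t ^ 2)) [Nonempty ι]
    {B : Finset ι} (hB : 2 * B.card ≤ Fintype.card ι) (A : Set ℕ) :
    convolution (B.piecewise (fun _ => A.indicator p) fun _ => p) m ≤
      d / (2 * π) * √(2 * π / b) / √(Fintype.card ι) * (∑' k, A.indicator p k) ^ B.card := by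
  have : (0 : ℝ) < Fintype.card ι := by exact_mod_cast Fintype.card_pos
  refine (convolution_le_of_norm_prod_charSum_le hd (summable_piecewise_indicator hp B A)
    (dvd_of_piecewise_indicator_ne_zero hpd B A) hdm (b := b * Fintype.card ι / 2)
    (by positivity) fun t ht => prod_norm_charSum_piecewise_indicator_le hp h0 hb.le
      (hφ t ht) hB A).trans_eq ?_
  rw [show π / (b * Fintype.card ι / 2) = 2 * π / b / Fintype.card ι by field_simp,
    Real.sqrt_div (by positivity)]
  ring

end UpperBound

/-! ### A local limit theorem for triangular arrays -/

theorem tendsto_one_add_pow_exp {ι : Type*} {l : Filter ι} {n : ι → ℕ} (hn : Tendsto n l atTop)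
    {g : ι → ℂ} {z : ℂ} (hg : Tendsto (fun i => (n i : ℂ) * g i) l (𝓝 z)) :
    Tendsto (fun i => (1 + g i) ^ n i) l (𝓝 (Complex.exp z)) := by
  have hinv : Tendsto (fun i => ((n i : ℂ))⁻¹) l (𝓝 0) :=
    (tendsto_inv_atTop_nhds_zero_nat (𝕜 := ℂ)).comp hn
  have hg0 : Tendsto g l (𝓝 0) := by
    refine (zero_mul z ▸ hinv.mul hg).congr' ((hn.eventually_ne_atTop 0).mono fun i hi => ?_)
    exact inv_mul_cancel_left₀ (Nat.cast_ne_zero.2 hi) _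
  have hO : (fun i => (n i : ℂ) * (Complex.log (1 + g i) - g i)) =O[l]
      fun i => (n i : ℂ) * g i ^ 2 :=
    (Asymptotics.isBigO_refl _ _).mul (Complex.log_sub_self_isBigO.comp_tendsto hg0)
  have hsq : Tendsto (fun i => (n i : ℂ) * g i ^ 2) l (𝓝 0) :=
    (mul_zero z ▸ hg.mul hg0).congr fun i => by ring
  have hlog : Tendsto (fun i => (n i : ℂ) * Complex.log (1 + g i)) l (𝓝 z) :=
    (zero_add z ▸ (hO.trans_tendsto hsq).add hg).congr fun i => by ring
  refine ((Complex.continuous_exp.tendsto _).comp hlog).congr' ?_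
  filter_upwards [hg0.eventually_ne (show (0 : ℂ) ≠ -1 by simp)] with i hi
  rw [Function.comp_apply, Complex.exp_nat_mul,
    Complex.exp_log fun h => hi (eq_neg_of_add_eq_zero_right h)]

theorem tendsto_natCast_mul_exp_sub_one_sub {ι : Type*} {l : Filter ι} {n : ι → ℕ}
    (hn : Tendsto n l atTop) {z : ι → ℂ} {a : ℂ}
    (hz : Tendsto (fun i => √(n i : ℝ) * z i) l (𝓝 a)) :
    Tendsto (fun i => (n i : ℂ) * (Complex.exp (z i) - 1 - z i)) l (𝓝 (a ^ 2 / 2)) := by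
  have hsqrt : Tendsto (fun i => √(n i : ℝ)) l atTop :=
    Real.tendsto_sqrt_atTop.comp (tendsto_natCast_atTop_atTop.comp hn)
  have hsq : ∀ i, (n i : ℂ) = (√(n i : ℝ) : ℂ) ^ 2 := fun i => by
    rw [← Complex.ofReal_pow, Real.sq_sqrt (Nat.cast_nonneg _), Complex.ofReal_natCast]
  have hz0 : Tendsto z l (𝓝 0) := by
    have hinv : Tendsto (fun i => ((√(n i : ℝ))⁻¹ : ℂ)) l (𝓝 0) := by
      simpa only [Function.comp_def, Complex.ofReal_inv, Complex.ofReal_zero] using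
        (Complex.continuous_ofReal.tendsto 0).comp (tendsto_inv_atTop_zero.comp hsqrt)
    refine (zero_mul a ▸ hinv.mul hz).congr' ((hsqrt.eventually_ne_atTop 0).mono fun i hi => ?_)
    exact inv_mul_cancel_left₀ (Complex.ofReal_ne_zero.2 hi) _
  have hO := (Asymptotics.isBigO_refl (fun i => (n i : ℂ)) l).mul
    ((Complex.exp_sub_sum_range_isBigO_pow 3).comp_tendsto hz0)
  have hcube : Tendsto (fun i => (n i : ℂ) * z i ^ 3) l (𝓝 0) :=
    (mul_zero (a ^ 2) ▸ (hz.pow 2).mul hz0).congr fun i => by rw [hsq]; ring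
  refine (zero_add (a ^ 2 / 2) ▸
    (hO.trans_tendsto hcube).add ((hz.pow 2).div_const 2)).congr fun i => ?_
  simp only [Function.comp_apply, Finset.sum_range_succ, Finset.sum_range_zero, hsq]
  norm_num [Nat.factorial]
  ring

theorem norm_exp_mul_I_sub_one_sub_le (u : ℝ) :
    ‖Complex.exp (u * Complex.I) - 1 - u * Complex.I‖ ≤ 2 * u ^ 2 := by
  have hu : ‖(u : ℂ) * Complex.I‖ = |u| := by simp
  rw [← sq_abs]
  rcases le_or_gt |u| 1 with h | h
  · have hquad := Complex.norm_exp_sub_one_sub_id_le (hu.trans_le h)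
    rw [hu] at hquad
    linarith [sq_nonneg |u|]
  · have hlin : ‖Complex.exp (u * Complex.I) - 1‖ ≤ |u| := by
      simpa only [mul_comm, Real.norm_eq_abs] using Real.norm_exp_I_mul_ofReal_sub_one_le (x := u)
    have htri := (norm_sub_le (Complex.exp (u * Complex.I) - 1) (u * Complex.I)).trans
      (add_le_add hlin hu.le)
    nlinarith

/-- The mean of a probability distribution on `ℕ`. -/
noncomputable def mean (p : ℕ → ℝ) : ℝ := ∑' k : ℕ, k * p k

/-- The variance of a probability distribution on `ℕ`. -/
noncomputable def variance (p : ℕ → ℝ) : ℝ := ∑' k : ℕ, (k - mean p) ^ 2 * p k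

theorem charSum_mul_exp_neg_mean {p : ℕ → ℝ} (hp : HasSum p 1)
    (hmean : Summable fun k : ℕ => k * p k) (t : ℝ) :
    charSum p t * Complex.exp ((-(mean p * t) : ℝ) * Complex.I) =
      1 + ∑' k : ℕ, p k • (Complex.exp (((k - mean p) * t : ℝ) * Complex.I) - 1 -
        ((k - mean p) * t : ℝ) * Complex.I) := by
  have hone : HasSum (fun k : ℕ => (p k : ℂ)) 1 := Complex.ofReal_one ▸ Complex.hasSum_ofReal.2 hp
  have hmean' : HasSum (fun k : ℕ => (k : ℂ) * p k) (mean p) := by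
    exact_mod_cast Complex.hasSum_ofReal.2 hmean.hasSum
  have hchar := (summable_norm_charSum hp.summable t).of_norm.hasSum.mul_right
    (Complex.exp ((-(mean p * t) : ℝ) * Complex.I))
  have hlin := (hmean'.sub (hone.mul_left (mean p : ℂ))).mul_right ((t : ℂ) * Complex.I)
  have hrem := (hchar.sub hone).sub hlin
  rw [mul_one, sub_self, zero_mul, sub_zero] at hrem
  rw [← charSum] at hrem
  have hterm : ∀ k : ℕ, p k • (Complex.exp (((k - mean p) * t : ℝ) * Complex.I) - 1 -
      ((k - mean p) * t : ℝ) * Complex.I) =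
      p k * Complex.exp (((k : ℝ) * t : ℝ) * Complex.I) *
        Complex.exp ((-(mean p * t) : ℝ) * Complex.I) - p k -
        (k * p k - mean p * p k) * (t * Complex.I) := fun k => by
    rw [mul_assoc (p k : ℂ), ← Complex.exp_add, Complex.real_smul,
      show (((k : ℝ) * t : ℝ) : ℂ) * Complex.I + ((-(mean p * t) : ℝ) : ℂ) * Complex.I =
        (((k - mean p) * t : ℝ) : ℂ) * Complex.I by push_cast; ring]
    push_cast
    ring
  rw [tsum_congr hterm, hrem.tsum_eq, add_sub_cancel]

section LocalIntegrand

variable {p : ℕ → ℝ} {d m n : ℕ}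

/-- The integrand in the Fourier inversion formula for the `n`-fold convolution of `p` at `m`, where
`p` lives on multiples of `d`, after the substitution `t = s / √n`. -/
noncomputable def localIntegrand (p : ℕ → ℝ) (d m n : ℕ) : ℝ → ℂ :=
  (Set.Ioc (-(√n * (π / d))) (√n * (π / d))).indicator fun s =>
    charSum p (s / √n) ^ n * Complex.exp ((-(m * (s / √n)) : ℝ) * Complex.I)

theorem aestronglyMeasurable_localIntegrand (hp : Summable p) :
    AEStronglyMeasurable (localIntegrand p d m n) := by
  have := continuous_charSum hp
  exact (Continuous.aestronglyMeasurable (by fun_prop)).indicator measurableSet_Ioc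

theorem norm_localIntegrand_le (hn : 0 < n) {c : ℝ}
    (hφ : ∀ t : ℝ, |t| ≤ π / d → ‖charSum p t‖ ≤ Real.exp (-c * t ^ 2)) (s : ℝ) :
    ‖localIntegrand p d m n s‖ ≤ Real.exp (-c * s ^ 2) := by
  have hn0 : (0 : ℝ) < n := by exact_mod_cast hn
  have hsqrt : 0 < √(n : ℝ) := Real.sqrt_pos.2 hn0
  rw [localIntegrand, Set.indicator_apply]
  split_ifs with hs
  · have hsd : |s / √n| ≤ π / d := by
      rw [abs_div, abs_of_pos hsqrt, div_le_iff₀ hsqrt, mul_comm]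
      exact abs_le.2 ⟨hs.1.le, hs.2⟩
    rw [norm_mul, Complex.norm_exp_ofReal_mul_I, mul_one, norm_pow]
    calc _ ≤ Real.exp (-c * (s / √n) ^ 2) ^ n := by gcongr; exact hφ _ hsd
      _ = Real.exp (-c * s ^ 2) := by
        rw [← Real.exp_nat_mul, div_pow, Real.sq_sqrt hn0.le]
        congr 1
        field_simp
  · rw [norm_zero]
    positivity

theorem integral_localIntegrand (hd : 0 < d) (hn : 0 < n) (hp : Summable p)
    (hpd : ∀ k, p k ≠ 0 → d ∣ k) (hdm : d ∣ m) :
    ∫ s, localIntegrand p d m n s =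
      (2 * π / d : ℝ) * ((√n * convolution (fun _ : Fin n => p) m : ℝ) : ℂ) := by
  have hsqrt : 0 < √(n : ℝ) := Real.sqrt_pos.2 (by exact_mod_cast hn)
  have hF := integral_prod_charSum_mul_exp hd (u := fun _ : Fin n => p) (fun _ => hp)
    (fun _ => hpd) hdm
  simp only [Finset.prod_const, Finset.card_univ, Fintype.card_fin] at hF
  rw [localIntegrand, integral_indicator measurableSet_Ioc,
    ← intervalIntegral.integral_of_le (neg_le_self (by positivity)),
    intervalIntegral.integral_comp_div
      (fun t => charSum p t ^ n * Complex.exp ((-(m * t) : ℝ) * Complex.I)) hsqrt.ne',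
    neg_div, mul_div_cancel_left₀ _ hsqrt.ne', hF, Complex.real_smul]
  push_cast
  ring

end LocalIntegrand

/-- The probability distributions `p i` on `ℕ` converge pointwise along `l` to `q`, and are
eventually bounded by a fixed sequence with a finite second moment. In particular their means and
variances converge. -/
structure DominatedLimit {ι : Type*} (l : Filter ι) (p : ι → ℕ → ℝ) (q : ℕ → ℝ) : Prop where
  nonneg : ∀ᶠ i in l, ∀ k, 0 ≤ p i k
  hasSum_one : ∀ᶠ i in l, HasSum (p i) 1
  tendsto : ∀ k, Tendsto (fun i => p i k) l (𝓝 (q k))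
  exists_bound : ∃ g : ℕ → ℝ, Summable (fun k : ℕ => (1 + (k : ℝ) ^ 2) * g k) ∧
    ∀ᶠ i in l, ∀ k, p i k ≤ g k

namespace DominatedLimit

variable {ι : Type*} {l : Filter ι} {p : ι → ℕ → ℝ} {q : ℕ → ℝ}

theorem tendsto_tsum_smul {E : Type*} [NormedAddCommGroup E] [NormedSpace ℝ E] [CompleteSpace E]
    (h : DominatedLimit l p q) {f : ι → ℕ → E} {f₀ : ℕ → E}
    (hf : ∀ k, Tendsto (fun i => f i k) l (𝓝 (f₀ k))) {C : ℝ}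
    (hC : ∀ᶠ i in l, ∀ k : ℕ, ‖f i k‖ ≤ C * (1 + (k : ℝ) ^ 2)) :
    Tendsto (fun i => ∑' k, p i k • f i k) l (𝓝 (∑' k, q k • f₀ k)) := by
  obtain ⟨g, hg, hpg⟩ := h.exists_bound
  refine tendsto_tsum_of_dominated_convergence (bound := fun k : ℕ => C * ((1 + (k : ℝ) ^ 2) * g k))
    (hg.mul_left C) (fun k => (h.tendsto k).smul (hf k)) ?_
  filter_upwards [h.nonneg, hpg, hC] with i hi hgi hCi k
  rw [norm_smul, Real.norm_of_nonneg (hi k)]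
  calc p i k * ‖f i k‖ ≤ g k * (C * (1 + (k : ℝ) ^ 2)) :=
        mul_le_mul (hgi k) (hCi k) (norm_nonneg _) ((hi k).trans (hgi k))
    _ = C * ((1 + (k : ℝ) ^ 2) * g k) := by ring

theorem eventually_summable_mul (h : DominatedLimit l p q) :
    ∀ᶠ i in l, Summable fun k : ℕ => k * p i k := by
  obtain ⟨g, hg, hpg⟩ := h.exists_bound
  filter_upwards [h.nonneg, hpg] with i hi hgi
  refine .of_nonneg_of_le (fun k => mul_nonneg k.cast_nonneg (hi k)) (fun k => ?_) hg
  exact mul_le_mul (by nlinarith [sq_nonneg ((k : ℝ) - 1)]) (hgi k) (hi k) (by positivity)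

theorem tendsto_mean (h : DominatedLimit l p q) :
    Tendsto (fun i => mean (p i)) l (𝓝 (mean q)) := by
  have hlim := h.tendsto_tsum_smul (f := fun _ k => (k : ℝ)) (f₀ := fun k => (k : ℝ)) (C := 1)
    (fun k => tendsto_const_nhds) (.of_forall fun _ k => by
      rw [Real.norm_of_nonneg k.cast_nonneg]
      nlinarith [sq_nonneg ((k : ℝ) - 1)])
  simpa only [smul_eq_mul, mul_comm, mean] using hlim

theorem tendsto_mul_tsum_smul_exp_sub (h : DominatedLimit l p q) {n : ι → ℕ}
    (hn : Tendsto n l atTop) (s : ℝ) :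
    Tendsto (fun i => (n i : ℂ) * ∑' k : ℕ, p i k •
      (Complex.exp (((k - mean (p i)) * (s / √(n i)) : ℝ) * Complex.I) - 1 -
        ((k - mean (p i)) * (s / √(n i)) : ℝ) * Complex.I)) l
      (𝓝 (∑' k : ℕ, q k • ((((k - mean q) * s : ℝ) * Complex.I) ^ 2 / 2))) := by
  simp only [← tsum_mul_left, mul_smul_comm]
  refine h.tendsto_tsum_smul (C := 4 * s ^ 2 * (2 + mean q ^ 2)) (fun k => ?_) ?_
  · refine tendsto_natCast_mul_exp_sub_one_sub hn ?_
    have hcoeff : Tendsto (fun i => (((k - mean (p i)) * s : ℝ) : ℂ) * Complex.I) l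
        (𝓝 (((k - mean q) * s : ℝ) * Complex.I)) :=
      ((Complex.continuous_ofReal.tendsto _).comp
        ((h.tendsto_mean.const_sub _).mul_const s)).mul_const _
    refine hcoeff.congr' ((hn.eventually_gt_atTop 0).mono fun i hi => ?_)
    have hsqrt : √(n i : ℝ) ≠ 0 := (Real.sqrt_pos.2 (by exact_mod_cast hi)).ne'
    rw [show (k - mean (p i)) * s = √(n i) * ((k - mean (p i)) * (s / √(n i))) by field_simp,
      Complex.ofReal_mul, mul_assoc]
  · filter_upwards [hn.eventually_gt_atTop 0,
      (h.tendsto_mean.pow 2).eventually_le_const (lt_add_one _)] with i hi hμ k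
    have hn0 : (0 : ℝ) < n i := by exact_mod_cast hi
    rw [norm_mul, Complex.norm_natCast]
    calc _ ≤ (n i : ℝ) * (2 * ((k - mean (p i)) * (s / √(n i))) ^ 2) := by
          gcongr; exact norm_exp_mul_I_sub_one_sub_le _
      _ = 2 * s ^ 2 * (k - mean (p i)) ^ 2 := by
          rw [mul_pow, div_pow, Real.sq_sqrt hn0.le]
          field_simp
      _ ≤ 2 * s ^ 2 * (2 * ((2 + mean q ^ 2) * (1 + (k : ℝ) ^ 2))) := by
          gcongr
          nlinarith [sq_nonneg ((k : ℝ) + mean (p i)),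
            mul_le_mul_of_nonneg_right hμ (sq_nonneg (k : ℝ))]
      _ = 4 * s ^ 2 * (2 + mean q ^ 2) * (1 + (k : ℝ) ^ 2) := by ring

theorem tendsto_charSum_pow (h : DominatedLimit l p q) {n : ι → ℕ} (hn : Tendsto n l atTop)
    (s : ℝ) :
    Tendsto (fun i => (charSum (p i) (s / √(n i)) *
      Complex.exp ((-(mean (p i) * (s / √(n i))) : ℝ) * Complex.I)) ^ n i) l
      (𝓝 ((Real.exp (-(variance q / 2) * s ^ 2) : ℝ) : ℂ)) := by
  have hlim : ∑' k : ℕ, q k • ((((k - mean q) * s : ℝ) * Complex.I) ^ 2 / 2) =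
      ((-(variance q / 2) * s ^ 2 : ℝ) : ℂ) := by
    rw [show -(variance q / 2) * s ^ 2 = variance q * (-(s ^ 2 / 2)) by ring, variance,
      ← tsum_mul_right, Complex.ofReal_tsum]
    refine tsum_congr fun k => ?_
    rw [Complex.real_smul, mul_pow, Complex.I_sq]
    push_cast
    ring
  rw [Complex.ofReal_exp, ← hlim]
  refine (tendsto_one_add_pow_exp hn (h.tendsto_mul_tsum_smul_exp_sub hn s)).congr' ?_
  filter_upwards [h.hasSum_one, h.eventually_summable_mul] with i hi hmi
  rw [charSum_mul_exp_neg_mean hi hmi]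

section NeBot

variable [l.NeBot]

theorem limit_nonneg (h : DominatedLimit l p q) (k : ℕ) : 0 ≤ q k :=
  ge_of_tendsto (h.tendsto k) (h.nonneg.mono fun _ hi => hi k)

theorem variance_pos (h : DominatedLimit l p q) (hq0 : 0 < q 0) (hq : ∃ k, 1 ≤ k ∧ 0 < q k) :
    0 < variance q := by
  obtain ⟨g, hg, hpg⟩ := h.exists_bound
  obtain ⟨k₀, hk₀, hqk₀⟩ := hq
  have hqg : ∀ k, q k ≤ g k := fun k => le_of_tendsto (h.tendsto k) (hpg.mono fun _ hi => hi k)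
  have hnonneg : ∀ k : ℕ, 0 ≤ (k - mean q) ^ 2 * q k := fun k =>
    mul_nonneg (sq_nonneg _) (h.limit_nonneg k)
  have hs : Summable fun k : ℕ => (k - mean q) ^ 2 * q k := by
    refine .of_nonneg_of_le hnonneg (fun k => ?_) (hg.mul_left (2 * (1 + mean q ^ 2)))
    rw [← mul_assoc]
    refine mul_le_mul ?_ (hqg k) (h.limit_nonneg k) (by positivity)
    nlinarith [sq_nonneg ((k : ℝ) + mean q), sq_nonneg ((k : ℝ) * mean q)]
  rcases eq_or_ne (mean q) 0 with hmean | hmean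
  · refine hs.tsum_pos hnonneg k₀ (mul_pos (sq_pos_of_pos ?_) hqk₀)
    rw [hmean, sub_zero]
    exact_mod_cast hk₀
  · refine hs.tsum_pos hnonneg 0 (mul_pos (sq_pos_of_ne_zero ?_) hq0)
    simpa using hmean

theorem exists_eventually_norm_charSum_le_exp (h : DominatedLimit l p q) (hq0 : 0 < q 0)
    {F : Finset ℕ} (hF : F.gcd id ≠ 0) (hFq : ∀ k ∈ F, q k ≠ 0) :
    ∃ c > 0, ∀ᶠ i in l, ∀ t : ℝ, |t| ≤ π / F.gcd id →
      ‖charSum (p i) t‖ ≤ Real.exp (-c * t ^ 2) := by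
  have hpos : ∀ k ∈ F, 0 < q 0 * q k := fun k hk =>
    mul_pos hq0 ((h.limit_nonneg k).lt_of_ne' (hFq k hk))
  obtain ⟨a, haF, ha⟩ := (((eventually_all_finset F).2 fun k hk =>
    Ioo_mem_nhdsGT (hpos k hk)).and self_mem_nhdsWithin).exists
  obtain ⟨c, hc, hbound⟩ := exists_norm_charSum_le_exp hF ha
  refine ⟨c, hc, ?_⟩
  have hap : ∀ᶠ i in l, ∀ k ∈ F, a < p i 0 * p i k := (eventually_all_finset F).2 fun k hk =>
    ((h.tendsto 0).mul (h.tendsto k)).eventually_const_lt (haF k hk).2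
  filter_upwards [h.nonneg, h.hasSum_one, hap] with i hi hsi hai
  exact hbound (p i) hsi hi fun k hk => (hai k hk).le

end NeBot

theorem tendsto_localIntegrand (h : DominatedLimit l p q) {d : ℕ} (hd : 0 < d) {m n : ι → ℕ}
    (hn : Tendsto n l atTop) (hmean : ∀ᶠ i in l, mean (p i) = m i / n i) (s : ℝ) :
    Tendsto (fun i => localIntegrand (p i) d (m i) (n i) s) l
      (𝓝 ((Real.exp (-(variance q / 2) * s ^ 2) : ℝ) : ℂ)) := by
  have hsqrt : Tendsto (fun i => √(n i : ℝ)) l atTop :=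
    Real.tendsto_sqrt_atTop.comp (tendsto_natCast_atTop_atTop.comp hn)
  have hmem := (hsqrt.atTop_mul_const (show 0 < π / d by positivity)).eventually_gt_atTop |s|
  refine (h.tendsto_charSum_pow hn s).congr' ?_
  filter_upwards [hmem, hmean, hn.eventually_gt_atTop 0] with i hi hmi hni
  have hn0 : (n i : ℝ) ≠ 0 := by exact_mod_cast hni.ne'
  have hs : s ∈ Set.Ioc (-(√(n i) * (π / d))) (√(n i) * (π / d)) :=
    ⟨(abs_lt.1 hi).1, (abs_lt.1 hi).2.le⟩
  rw [localIntegrand, Set.indicator_of_mem hs, mul_pow, ← Complex.exp_nat_mul, hmi,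
    show -((m i : ℝ) * (s / √(n i))) = n i * -(m i / n i * (s / √(n i))) by field_simp]
  push_cast
  ring_nf

/-- The local limit theorem, for the probability that a sum of `n i` independent variables with
law `p i` equals its mean. -/
theorem tendsto_sqrt_mul_convolution [l.IsCountablyGenerated] (h : DominatedLimit l p q) {d : ℕ}
    (hd : 0 < d) (hpd : ∀ᶠ i in l, ∀ k, p i k ≠ 0 → d ∣ k) {m n : ι → ℕ}
    (hn : Tendsto n l atTop) (hdm : ∀ᶠ i in l, d ∣ m i)
    (hmean : ∀ᶠ i in l, mean (p i) = m i / n i) {c : ℝ} (hc : 0 < c)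
    (hφ : ∀ᶠ i in l, ∀ t : ℝ, |t| ≤ π / d → ‖charSum (p i) t‖ ≤ Real.exp (-c * t ^ 2)) :
    Tendsto (fun i => √(n i) * convolution (fun _ : Fin (n i) => p i) (m i)) l
      (𝓝 (d / (2 * π) * √(π / (variance q / 2)))) := by
  have hd0 : (d : ℝ) ≠ 0 := by exact_mod_cast hd.ne'
  have hint : Tendsto (fun i => ∫ s, localIntegrand (p i) d (m i) (n i) s) l
      (𝓝 (∫ s : ℝ, ((Real.exp (-(variance q / 2) * s ^ 2) : ℝ) : ℂ))) := by
    refine tendsto_integral_filter_of_dominated_convergence (fun s => Real.exp (-c * s ^ 2))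
      (h.hasSum_one.mono fun i hi => aestronglyMeasurable_localIntegrand hi.summable) ?_
      (integrable_exp_neg_mul_sq hc) (.of_forall fun s => h.tendsto_localIntegrand hd hn hmean s)
    filter_upwards [hφ, hn.eventually_gt_atTop 0] with i hi hni
    exact .of_forall fun s => norm_localIntegrand_le hni hi s
  rw [integral_complex_ofReal, integral_gaussian] at hint
  refine (((Complex.continuous_re.tendsto _).comp hint).const_mul (d / (2 * π))).congr' ?_
  filter_upwards [h.hasSum_one, hpd, hdm, hn.eventually_gt_atTop 0] with i hi hpi hmi hni
  rw [Function.comp_apply, integral_localIntegrand hd hni hi.summable hpi hmi,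
    ← Complex.ofReal_mul, Complex.ofReal_re]
  field_simp

/-- In probabilistic terms, conditioning on the value of the sum costs only a constant factor. -/
theorem exists_eventually_convolution_le [l.NeBot] [l.IsCountablyGenerated]
    (h : DominatedLimit l p q) (hq0 : 0 < q 0) (hq : ∃ k, 1 ≤ k ∧ 0 < q k)
    (hpq : ∀ᶠ i in l, ∀ k, p i k ≠ 0 → q k ≠ 0) {m n : ι → ℕ} (hn : Tendsto n l atTop)
    (hmean : ∀ᶠ i in l, mean (p i) = m i / n i)
    (hm : ∀ᶠ i in l, convolution (fun _ : Fin (n i) => p i) (m i) ≠ 0) :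
    ∃ C > 0, ∀ᶠ i in l, ∀ B : Finset (Fin (n i)), 2 * B.card ≤ n i → ∀ A : Set ℕ,
      convolution (B.piecewise (fun _ => A.indicator (p i)) fun _ => p i) (m i) ≤
        C * (∑' k, A.indicator (p i) k) ^ B.card *
          convolution (fun _ : Fin (n i) => p i) (m i) := by
  obtain ⟨F, hFq, hF⟩ := exists_finset_gcd_dvd {k | q k ≠ 0}
  set d := F.gcd id
  have hd : d ≠ 0 := by
    obtain ⟨k, hk, hqk⟩ := hq
    exact ne_zero_of_dvd_ne_zero (Nat.one_le_iff_ne_zero.1 hk) (hF k hqk.ne')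
  have hd0 := Nat.pos_of_ne_zero hd
  have hpd : ∀ᶠ i in l, ∀ k, p i k ≠ 0 → d ∣ k := hpq.mono fun i hi k hk => hF k (hi k hk)
  have hdm : ∀ᶠ i in l, d ∣ m i := by
    filter_upwards [hpd, hm] with i hi hmi using dvd_of_convolution_ne_zero (fun _ => hi) hmi
  obtain ⟨c, hc, hφ⟩ := h.exists_eventually_norm_charSum_le_exp hq0 hd hFq
  have hv := h.variance_pos hq0 hq
  have hlocal := h.tendsto_sqrt_mul_convolution hd0 hpd hn hdm hmean hc hφ
  set L := d / (2 * π) * √(π / (variance q / 2))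
  have hL : 0 < L := by positivity
  set K := d / (2 * π) * √(2 * π / c)
  refine ⟨K / (L / 2), by positivity, ?_⟩
  filter_upwards [h.nonneg, h.hasSum_one, hpd, hdm, hφ, hn.eventually_gt_atTop 0,
    hlocal.eventually_const_lt (half_lt_self hL)] with i h0i hsi hpi hmi hφi hni hLi B hB A
  have : Nonempty (Fin (n i)) := Fin.pos_iff_nonempty.1 hni
  have hsqrt : 0 < √(n i : ℝ) := Real.sqrt_pos.2 (by exact_mod_cast hni)
  have hupper := convolution_piecewise_indicator_le hsi.summable h0i hd0 hpi hmi hc hφi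
    (B := B) (by rwa [Fintype.card_fin]) A
  rw [Fintype.card_fin] at hupper
  have hA : 0 ≤ ∑' k, A.indicator (p i) k :=
    tsum_nonneg fun k => Set.indicator_nonneg (fun k _ => h0i k) k
  calc _ ≤ K / √(n i) * (∑' k, A.indicator (p i) k) ^ B.card := hupper
    _ = K / (L / 2) * (∑' k, A.indicator (p i) k) ^ B.card * (L / 2 / √(n i)) := by field_simp
    _ ≤ _ := by
      gcongr
      rw [div_le_iff₀' hsqrt]
      exact hLi.le

end DominatedLimit

/-! ### Exponential tilting -/

section Tilt

variable {w : ℕ → ℝ≥0} {t : ℝ}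

/-- The exponentially tilted weights `w_k t^k / Φ(t)`; if the series `Φ(t)` converges, this is a
probability distribution on `ℕ`, with mean `Ψ(t)`. -/
noncomputable def tilt (w : ℕ → ℝ≥0) (t : ℝ) (k : ℕ) : ℝ := (w k : ℝ) * t ^ k / realGen w t

theorem tilt_nonneg (ht : 0 ≤ t) (k : ℕ) : 0 ≤ tilt w t k :=
  div_nonneg (by positivity) (tsum_nonneg fun k => by positivity)

theorem tilt_pos (hw0 : 0 < w 0) (ht : t ∈ convergenceInterval w) (ht0 : 0 < t) {k : ℕ}
    (hk : w k ≠ 0) : 0 < tilt w t k :=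
  div_pos (mul_pos (NNReal.coe_pos.2 (pos_iff_ne_zero.2 hk)) (pow_pos ht0 k)) (realGen_pos hw0 ht)

theorem ne_zero_of_tilt_ne_zero {k : ℕ} (hk : tilt w t k ≠ 0) : w k ≠ 0 :=
  fun h => hk (by simp [tilt, h])

theorem hasSum_tilt (hw0 : 0 < w 0) (ht : t ∈ convergenceInterval w) : HasSum (tilt w t) 1 := by
  have h := (hasSum_realGen ht).div_const (realGen w t)
  rwa [div_self (realGen_pos hw0 ht).ne'] at h

theorem mean_tilt (w : ℕ → ℝ≥0) (t : ℝ) : mean (tilt w t) = realPsi w t := by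
  simp only [mean, tilt, realPsi, realNum, ← tsum_div_const, mul_div_assoc]

theorem tilt_le_one (hw0 : 0 < w 0) (ht : t ∈ convergenceInterval w) (k : ℕ) : tilt w t k ≤ 1 :=
  le_hasSum (hasSum_tilt hw0 ht) k fun k _ => tilt_nonneg ht.1 k

theorem tilt_le (hw0 : 0 < w 0) (ht : t ∈ convergenceInterval w) {r : ℝ} (htr : t ≤ r) (k : ℕ) :
    tilt w t k ≤ (w k : ℝ) * r ^ k / w 0 := by
  have h0 : (0 : ℝ) < w 0 := hw0
  have hr := ht.1.trans htr
  exact div_le_div₀ (by positivity) (by have := ht.1; gcongr) h0 (le_realGen ht)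

theorem dominatedLimit_tilt (hw0 : 0 < w 0) (ht : t ∈ convergenceInterval w) (ht0 : 0 < t)
    {ι : Type*} {l : Filter ι} {T : ι → ℝ} (hT : Tendsto T l (𝓝 t)) :
    DominatedLimit l (fun i => tilt w (T i)) (tilt w t) := by
  have hmem := hT.eventually_mem (convergenceInterval_mem_nhds ht ht0)
  obtain ⟨R, hR, htR⟩ := exists_gt_mem_convergenceInterval ht
  refine ⟨hmem.mono fun i hi => tilt_nonneg hi.1, hmem.mono fun i hi => hasSum_tilt hw0 hi,
    fun k => ?_, fun k => (w k : ℝ) * R ^ k / w 0, ?_, ?_⟩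
  · have hgen := continuousOn_realGen.continuousAt (convergenceInterval_mem_nhds ht ht0)
    exact ((hT.pow k).const_mul _).div (hgen.tendsto.comp hT) (realGen_pos hw0 ht).ne'
  · refine (((summable_weight hR).add (summable_pow_mul_weight hR 2)).div_const (w 0 : ℝ)).congr
      fun k => ?_
    ring
  · filter_upwards [hmem, hT.eventually_lt_const htR] with i hi hiR
    exact tilt_le hw0 hi hiR.le

end Tilt

/-! ### Comparison of the random allocation with independent variables -/

section Comparison

variable {w : ℕ → ℝ≥0} {t : ℝ} {m n : ℕ}

theorem convolution_piecewise_indicator {ι : Type*} [Fintype ι] [DecidableEq ι] (p : ℕ → ℝ)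
    (B : Finset ι) (A : Set ℕ) (m : ℕ) :
    convolution (B.piecewise (fun _ => A.indicator p) fun _ => p) m =
      ∑ y ∈ Finset.univ.piAntidiag m,
        {y : ι → ℕ | ∀ i ∈ B, y i ∈ A}.indicator (fun y => ∏ i, p (y i)) y := by
  refine Finset.sum_congr rfl fun y _ => ?_
  by_cases hy : y ∈ {y : ι → ℕ | ∀ i ∈ B, y i ∈ A}
  · rw [Set.indicator_of_mem hy]
    refine Finset.prod_congr rfl fun i _ => ?_
    by_cases hi : i ∈ B
    · rw [Finset.piecewise_eq_of_mem _ _ _ hi, Set.indicator_of_mem (hy i hi)]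
    · rw [Finset.piecewise_eq_of_notMem _ _ _ hi]
  · rw [Set.indicator_of_notMem hy]
    obtain ⟨i, hi, hiA⟩ : ∃ i ∈ B, y i ∉ A := by simpa using hy
    refine Finset.prod_eq_zero (Finset.mem_univ i) ?_
    rw [Finset.piecewise_eq_of_mem _ _ _ hi, Set.indicator_of_notMem hiA]

theorem prod_tilt {y : Fin n → ℕ} (hy : y ∈ allocations m n) :
    ∏ i, tilt w t (y i) = weight w y * (t ^ m / realGen w t ^ n) := by
  simp only [tilt, Finset.prod_div_distrib, Finset.prod_mul_distrib, Finset.prod_pow_eq_pow_sum,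
    mem_allocations.1 hy, Finset.prod_const, Finset.card_univ, Fintype.card_fin, weight,
    NNReal.coe_prod, mul_div_assoc]

theorem convolution_tilt (w : ℕ → ℝ≥0) (t : ℝ) (m n : ℕ) :
    convolution (fun _ : Fin n => tilt w t) m = partitionFun w m n * (t ^ m / realGen w t ^ n) := by
  rw [partitionFun, NNReal.coe_sum, Finset.sum_mul]
  exact Finset.sum_congr rfl fun y hy => prod_tilt hy

theorem allocLaw_apply (w : ℕ → ℝ≥0) (m n : ℕ) (E : Set (Fin n → ℕ)) :
    allocLaw w m n E =
      ENNReal.ofReal ((∑ y ∈ allocations m n, E.indicator (fun y => (weight w y : ℝ)) y) /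
        partitionFun w m n) := by
  classical
  rw [Finset.sum_div, ENNReal.ofReal_sum_of_nonneg fun y _ =>
    div_nonneg (Set.indicator_nonneg (fun _ _ => NNReal.coe_nonneg _) y) (NNReal.coe_nonneg _)]
  simp only [allocLaw, Measure.coe_finsetSum, Finset.sum_apply, Measure.smul_apply, smul_eq_mul,
    Measure.dirac_apply, Set.indicator_apply, Pi.one_apply]
  refine Finset.sum_congr rfl fun y _ => ?_
  split_ifs
  · rw [mul_one, ← NNReal.coe_div, ENNReal.ofReal_coe_nnreal]
  · simp

theorem allocLaw_setOf_forall_mem (hw0 : 0 < w 0) (ht : t ∈ convergenceInterval w) (ht0 : 0 < t)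
    (B : Finset (Fin n)) (A : Set ℕ) :
    allocLaw w m n {y | ∀ i ∈ B, y i ∈ A} =
      ENNReal.ofReal (convolution (B.piecewise (fun _ => A.indicator (tilt w t)) fun _ => tilt w t)
        m / convolution (fun _ : Fin n => tilt w t) m) := by
  classical
  have hgen := realGen_pos hw0 ht
  have hconst : t ^ m / realGen w t ^ n ≠ 0 := by positivity
  rw [allocLaw_apply, convolution_tilt, convolution_piecewise_indicator,
    ← mul_div_mul_right _ _ hconst, Finset.sum_mul]
  congr 2
  refine Finset.sum_congr rfl fun y hy => ?_
  rw [← Set.indicator_mul_const, Set.indicator_apply, Set.indicator_apply, prod_tilt hy]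

/-- For the allocation of `m` balls in `n` boxes, prescribing that at most half of the boxes have
their contents in a set `A` costs at most `C` times what it costs for independent contents with law
`tilt w t`. -/
def TiltDominated (w : ℕ → ℝ≥0) (m n : ℕ) (t C : ℝ) : Prop :=
  ∀ B : Finset (Fin n), 2 * B.card ≤ n → ∀ A : Set ℕ,
    allocLaw w m n {y | ∀ i ∈ B, y i ∈ A} ≤
      ENNReal.ofReal (C * (∑' k, A.indicator (tilt w t) k) ^ B.card)

theorem exists_eventually_tiltDominated (hw0 : 0 < w 0) (hw : ∃ k, 1 ≤ k ∧ 0 < w k)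
    (ht : t ∈ convergenceInterval w) (ht0 : 0 < t) {ι : Type*} {l : Filter ι} [l.NeBot]
    [l.IsCountablyGenerated] {T : ι → ℝ} (hT : Tendsto T l (𝓝 t)) {m n : ι → ℕ}
    (hn : Tendsto n l atTop) (hTmn : ∀ᶠ i in l, realPsi w (T i) = m i / n i)
    (hZ : ∀ᶠ i in l, 0 < partitionFun w (m i) (n i)) :
    ∃ C > 0, ∀ᶠ i in l, TiltDominated w (m i) (n i) (T i) C := by
  have hgood : ∀ᶠ i in l, T i ∈ convergenceInterval w ∧ 0 < T i :=
    (hT.eventually_mem (convergenceInterval_mem_nhds ht ht0)).and (hT.eventually_const_lt ht0)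
  have hpos : ∀ᶠ i in l, 0 < convolution (fun _ : Fin (n i) => tilt w (T i)) (m i) := by
    filter_upwards [hgood, hZ] with i ⟨hi, hi0⟩ hZi
    have hgen := realGen_pos hw0 hi
    have : (0 : ℝ) < partitionFun w (m i) (n i) := hZi
    rw [convolution_tilt]
    positivity
  obtain ⟨k, hk, hwk⟩ := hw
  obtain ⟨C, hC, hdom⟩ := (dominatedLimit_tilt hw0 ht ht0 hT).exists_eventually_convolution_le
    (tilt_pos hw0 ht ht0 hw0.ne') ⟨k, hk, tilt_pos hw0 ht ht0 hwk.ne'⟩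
    (.of_forall fun i k hk => (tilt_pos hw0 ht ht0 (ne_zero_of_tilt_ne_zero hk)).ne') hn
    (by simpa only [mean_tilt] using hTmn) (hpos.mono fun i hi => hi.ne')
  refine ⟨C, hC, ?_⟩
  filter_upwards [hgood, hpos, hdom] with i ⟨hi, hi0⟩ hposi hdomi B hB A
  rw [allocLaw_setOf_forall_mem hw0 hi hi0]
  exact ENNReal.ofReal_le_ofReal ((div_le_iff₀ hposi).2 (hdomi B hB A))

end Comparison

/-! ### Order statistics -/

section OrderStatistics

theorem le_getD_iff_lt_countP {α : Type*} [LinearOrder α] {k d : α} (hdk : d < k) {l : List α}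
    (hl : l.Pairwise (· ≥ ·)) (i : ℕ) : k ≤ l.getD i d ↔ i < l.countP (k ≤ ·) := by
  induction l generalizing i with
  | nil => simpa using hdk
  | cons a l ih =>
    obtain ⟨ha, hl⟩ := List.pairwise_cons.1 hl
    rw [List.countP_cons]
    by_cases hka : k ≤ a
    · cases i with
      | zero => simp [hka]
      | succ i => simpa [hka] using ih hl i
    · have hcount : l.countP (k ≤ ·) = 0 :=
        List.countP_eq_zero.2 fun b hb => by simpa using (ha b hb).trans_lt (not_le.1 hka)
      cases i with
      | zero => simp [hka, hcount]
      | succ i => simpa [hka, hcount] using ih hl i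

variable {n : ℕ} {y : Fin n → ℕ} {j k : ℕ}

theorem le_nthLargest_iff (hj : 1 ≤ j) (hk : 0 < k) :
    k ≤ nthLargest y j ↔ j ≤ (Finset.univ.filter fun i => k ≤ y i).card := by
  rw [nthLargest, le_getD_iff_lt_countP hk (Multiset.pairwise_sort _ _), ← Multiset.coe_countP,
    Multiset.sort_eq, Multiset.countP_map, Finset.card_def, Finset.filter_val]
  omega

theorem le_nthLargest_one_iff (hk : 0 < k) : k ≤ nthLargest y 1 ↔ ∃ i, k ≤ y i := by
  simp [le_nthLargest_iff le_rfl hk, Finset.one_le_card, Finset.filter_nonempty_iff]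

theorem nthLargest_le_nthLargest_one (y : Fin n → ℕ) (hj : 1 ≤ j) :
    nthLargest y j ≤ nthLargest y 1 := by
  rcases (nthLargest y j).eq_zero_or_pos with h | h
  · exact h ▸ Nat.zero_le _
  · exact (le_nthLargest_iff le_rfl h).2 (hj.trans ((le_nthLargest_iff hj h).1 le_rfl))

theorem exists_forall_ne_of_nthLargest_lt (hj : 1 ≤ j) (hk : 0 < k) {α : Type*}
    (e : Fin j × α ↪ Fin n) (hy : nthLargest y j < k) : ∃ l, ∀ a, y (e (l, a)) ≠ k := by
  contrapose! hy
  choose a ha using hy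
  have hinj : Function.Injective fun l => e (l, a l) :=
    fun l l' h => congrArg Prod.fst (e.injective h)
  rw [le_nthLargest_iff hj hk]
  simpa using Finset.card_le_card (s := Finset.univ.map ⟨_, hinj⟩)
    (t := Finset.univ.filter fun i => k ≤ y i) fun i hi => by
      obtain ⟨l, -, rfl⟩ := Finset.mem_map.1 hi
      simp [ha l]

end OrderStatistics

/-! ### Convergence in probability from tail bounds -/

section InProbability

variable {Ω : ℕ → Type*} [∀ i, MeasurableSpace (Ω i)] {P : ∀ i, Measure (Ω i)} {X : ∀ i, Ω i → ℝ}
  {a : ℕ → ℝ} {c : ℝ}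

theorem tendstoInProb_div_of_tails (ha : ∀ᶠ i in atTop, 0 < a i) (hX : ∀ i x, 0 ≤ X i x)
    (hupper : ∀ b, c < b → Tendsto (fun i => P i {x | b * a i ≤ X i x}) atTop (𝓝 0))
    (hlower : ∀ b, 0 < b → b < c → Tendsto (fun i => P i {x | X i x < b * a i}) atTop (𝓝 0)) :
    TendstoInProb P (fun i x => X i x / a i) c := by
  intro ε hε
  have hlower_all (b : ℝ) (hb : b < c) :
      Tendsto (fun i => P i {x | X i x < b * a i}) atTop (𝓝 0) := by
    rcases lt_or_ge 0 b with hb0 | hb0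
    · exact hlower b hb0 hb
    · refine tendsto_const_nhds.congr' (ha.mono fun i hi => ?_)
      have hempty : {x | X i x < b * a i} = ∅ := Set.eq_empty_of_forall_notMem fun x hx =>
        hx.not_ge ((mul_nonpos_of_nonpos_of_nonneg hb0 hi.le).trans (hX i x))
      simp only [hempty, measure_empty]
  have hsum := (hupper (c + ε) (by linarith)).add (hlower_all (c - ε / 2) (by linarith))
  rw [add_zero] at hsum
  refine tendsto_of_tendsto_of_tendsto_of_le_of_le' tendsto_const_nhds hsum
    (.of_forall fun _ => zero_le) (ha.mono fun i hi => ?_)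
  refine (measure_mono fun x (hx : ε ≤ |X i x / a i - c|) => ?_).trans (measure_union_le _ _)
  rcases le_abs.1 hx with h | h
  · exact .inl ((le_div_iff₀ hi).1 (by linarith))
  · exact .inr ((div_lt_iff₀ hi).1 (by linarith))

theorem isLittleOp_max_sub_of_upper_tail (ha : ∀ᶠ i in atTop, 0 < a i)
    (hupper : ∀ b, c < b → Tendsto (fun i => P i {x | b * a i ≤ X i x}) atTop (𝓝 0)) :
    IsLittleOp P (fun i x => max (X i x - c * a i) 0) a := by
  refine tendstoInProb_div_of_tails ha (fun _ _ => le_max_right _ _) (fun b hb => ?_)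
    fun b hb0 hb => absurd hb hb0.not_gt
  refine (hupper (c + b) (by linarith)).congr' (ha.mono fun i hi => congrArg (P i) ?_)
  ext x
  simp only [Set.mem_ofPred_eq, le_max_iff, (mul_pos hb hi).not_ge, or_false, le_sub_iff_add_le,
    add_mul, add_comm]

end InProbability

/-! ### Tails of the order statistics -/

section TiltTails

variable {w : ℕ → ℝ≥0} {t : ℝ}

theorem tsum_indicator_Ici_tilt_le (hw0 : 0 < w 0) (ht : t ∈ convergenceInterval w) {r : ℝ}
    (hr : r ∈ convergenceInterval w) (hr0 : 0 < r) (htr : t ≤ r) (K : ℕ) :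
    ∑' k, (Set.Ici K).indicator (tilt w t) k ≤ realGen w r / w 0 * (t / r) ^ K := by
  have ht0 := ht.1
  have : (0 : ℝ) < w 0 := hw0
  have hsum := ((hasSum_realGen hr).div_const (w 0 : ℝ)).mul_right ((t / r) ^ K)
  rw [← hsum.tsum_eq]
  refine ((hasSum_tilt hw0 ht).summable.indicator _).tsum_le_tsum (fun k => ?_) hsum.summable
  rw [Set.indicator_apply]
  split_ifs with hk
  · have hpow : (t / r) ^ k ≤ (t / r) ^ K :=
      pow_le_pow_of_le_one (by positivity) ((div_le_one hr0).2 htr) hk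
    calc tilt w t k ≤ (w k : ℝ) * t ^ k / w 0 := tilt_le hw0 ht le_rfl k
      _ = (w k : ℝ) * r ^ k / w 0 * (t / r) ^ k := by rw [div_pow]; field_simp
      _ ≤ _ := by gcongr
  · positivity

theorem tsum_indicator_compl_singleton_tilt (hw0 : 0 < w 0) (ht : t ∈ convergenceInterval w)
    (K : ℕ) : ∑' k, ({K}ᶜ : Set ℕ).indicator (tilt w t) k = 1 - tilt w t K := by
  have hsingle : HasSum (({K} : Set ℕ).indicator (tilt w t)) (tilt w t K) := by
    simpa using hasSum_single (f := ({K} : Set ℕ).indicator (tilt w t)) K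
      fun i hi => Set.indicator_of_notMem (by simpa using hi) _
  rw [Set.indicator_compl]
  exact ((hasSum_tilt hw0 ht).sub hsingle).tsum_eq

namespace TiltDominated

variable {m n j K : ℕ} {C : ℝ}

theorem measure_le_nthLargest_le (h : TiltDominated w m n t C) (hn : 2 ≤ n) (hj : 1 ≤ j)
    (hK : 0 < K) : allocLaw w m n {y | K ≤ nthLargest y j} ≤
      ENNReal.ofReal (n * (C * ∑' k, (Set.Ici K).indicator (tilt w t) k)) :=
  calc allocLaw w m n {y | K ≤ nthLargest y j}
      ≤ allocLaw w m n (⋃ i : Fin n, {y | ∀ l ∈ ({i} : Finset (Fin n)), y l ∈ Set.Ici K}) := by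
        refine measure_mono fun y (hy : K ≤ nthLargest y j) => ?_
        obtain ⟨i, hi⟩ :=
          (le_nthLargest_one_iff hK).1 (hy.trans (nthLargest_le_nthLargest_one y hj))
        exact Set.mem_iUnion.2 ⟨i, by simpa using hi⟩
    _ ≤ ∑ i : Fin n, allocLaw w m n {y | ∀ l ∈ ({i} : Finset (Fin n)), y l ∈ Set.Ici K} :=
        measure_iUnion_fintype_le _ _
    _ ≤ ∑ _i : Fin n, ENNReal.ofReal (C * ∑' k, (Set.Ici K).indicator (tilt w t) k) :=
        Finset.sum_le_sum fun i _ => by simpa using h {i} (by simpa using hn) (Set.Ici K)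
    _ = _ := by
        rw [Finset.sum_const, Finset.card_univ, Fintype.card_fin, nsmul_eq_mul,
          ENNReal.ofReal_mul n.cast_nonneg, ENNReal.ofReal_natCast]

theorem measure_nthLargest_lt_le (h : TiltDominated w m n t C) (hw0 : 0 < w 0)
    (ht : t ∈ convergenceInterval w) (hj : 1 ≤ j) (hK : 0 < K) {s : ℕ} (hs : 2 * (j * s) ≤ n) :
    allocLaw w m n {y | nthLargest y j < K} ≤
      ENNReal.ofReal (j * (C * (1 - tilt w t K) ^ s)) := by
  let e : Fin j × Fin s ↪ Fin n :=
    finProdFinEquiv.toEmbedding.trans (Fin.castLEEmb (by omega))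
  let block (l : Fin j) : Finset (Fin n) :=
    Finset.univ.map ((Function.Embedding.sectR l (Fin s)).trans e)
  have hcard (l : Fin j) : (block l).card = s := by simp [block]
  have hblock (l : Fin j) : 2 * (block l).card ≤ n := by rw [hcard]; nlinarith
  calc allocLaw w m n {y | nthLargest y j < K}
      ≤ allocLaw w m n (⋃ l : Fin j, {y | ∀ i ∈ block l, y i ∈ ({K}ᶜ : Set ℕ)}) := by
        refine measure_mono fun y hy => ?_
        obtain ⟨l, hl⟩ := exists_forall_ne_of_nthLargest_lt hj hK e hy
        exact Set.mem_iUnion.2 ⟨l, by simpa [block] using hl⟩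
    _ ≤ ∑ l : Fin j, allocLaw w m n {y | ∀ i ∈ block l, y i ∈ ({K}ᶜ : Set ℕ)} :=
        measure_iUnion_fintype_le _ _
    _ ≤ ∑ _l : Fin j, ENNReal.ofReal (C * (1 - tilt w t K) ^ s) :=
        Finset.sum_le_sum fun l _ => by
          simpa only [hcard, tsum_indicator_compl_singleton_tilt hw0 ht] using
            h (block l) (hblock l) {K}ᶜ
    _ = _ := by
        rw [Finset.sum_const, Finset.card_univ, Fintype.card_fin, nsmul_eq_mul,
          ENNReal.ofReal_mul j.cast_nonneg, ENNReal.ofReal_natCast]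

theorem measure_nthLargest_lt_le_exp (h : TiltDominated w m n t C) (hC : 0 ≤ C) (hw0 : 0 < w 0)
    (ht : t ∈ convergenceInterval w) (hj : 1 ≤ j) (hK : 0 < K) :
    allocLaw w m n {y | nthLargest y j < K} ≤
      ENNReal.ofReal (j * (C * Real.exp (1 - n * tilt w t K / (2 * j)))) := by
  have hp1 := tilt_le_one hw0 ht K
  have hp0 := tilt_nonneg ht.1 (w := w) K
  have : (0 : ℝ) < j := by exact_mod_cast hj
  set s := n / (2 * j)
  have hs : (n : ℝ) / (2 * j) ≤ s + 1 := by
    rw [div_le_iff₀' (by positivity)]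
    exact_mod_cast (Nat.lt_mul_div_succ n (by omega)).le
  refine (h.measure_nthLargest_lt_le hw0 ht hj hK (s := s)
    (by simpa only [mul_assoc] using Nat.mul_div_le n (2 * j))).trans ?_
  gcongr
  calc (1 - tilt w t K) ^ s ≤ Real.exp (-tilt w t K) ^ s := by
        gcongr
        exact Real.one_sub_le_exp_neg _
    _ = Real.exp (-(s * tilt w t K)) := by rw [← Real.exp_nat_mul, mul_neg]
    _ ≤ Real.exp (1 - n * tilt w t K / (2 * j)) := by
        rw [mul_div_right_comm]
        gcongr
        nlinarith

end TiltDominated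

end TiltTails

section Asymptotics

variable {ι : Type*} {l : Filter ι} {n : ι → ℕ} {x : ι → ℝ} {a b : ℝ}

theorem exists_natCast_mul_pow_ceil_eq_exp (hn : Tendsto n l atTop) (hx : Tendsto x l (𝓝 a))
    (ha : 0 < a) (hb : 0 ≤ b) :
    ∃ f : ι → ℝ, Tendsto f l (𝓝 (1 + b * Real.log a)) ∧
      ∀ᶠ i in l, n i * x i ^ ⌈b * Real.log (n i)⌉₊ = Real.exp (Real.log (n i) * f i) := by
  have hlog : Tendsto (fun i => Real.log (n i)) l atTop :=
    Real.tendsto_log_atTop.comp (tendsto_natCast_atTop_atTop.comp hn)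
  refine ⟨fun i => 1 + ⌈b * Real.log (n i)⌉₊ / Real.log (n i) * Real.log (x i),
    (((tendsto_nat_ceil_mul_div_atTop hb).comp hlog).mul (hx.log ha.ne')).const_add 1, ?_⟩
  filter_upwards [hlog.eventually_ne_atTop 0, hx.eventually_const_lt ha,
    hn.eventually_gt_atTop 0] with i hlogi hxi hni
  rw [mul_add, mul_one, ← mul_assoc, mul_div_cancel₀ _ hlogi, Real.exp_add,
    Real.exp_log (by exact_mod_cast hni), Real.exp_nat_mul, Real.exp_log hxi]

theorem tendsto_natCast_mul_pow_ceil_zero (hn : Tendsto n l atTop) (hx : Tendsto x l (𝓝 a))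
    (ha : 0 < a) (hb : 0 ≤ b) (hab : b * Real.log a < -1) :
    Tendsto (fun i => n i * x i ^ ⌈b * Real.log (n i)⌉₊) l (𝓝 0) := by
  obtain ⟨f, hf, heq⟩ := exists_natCast_mul_pow_ceil_eq_exp hn hx ha hb
  exact (Real.tendsto_exp_atBot.comp ((Real.tendsto_log_atTop.comp
    (tendsto_natCast_atTop_atTop.comp hn)).atTop_mul_neg (by linarith) hf)).congr' <|
      heq.mono fun i hi => hi.symm

theorem tendsto_natCast_mul_pow_ceil_atTop (hn : Tendsto n l atTop) (hx : Tendsto x l (𝓝 a))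
    (ha : 0 < a) (hb : 0 ≤ b) (hab : -1 < b * Real.log a) :
    Tendsto (fun i => n i * x i ^ ⌈b * Real.log (n i)⌉₊) l atTop := by
  obtain ⟨f, hf, heq⟩ := exists_natCast_mul_pow_ceil_eq_exp hn hx ha hb
  exact (Real.tendsto_exp_atTop.comp ((Real.tendsto_log_atTop.comp
    (tendsto_natCast_atTop_atTop.comp hn)).atTop_mul_pos (by linarith) hf)).congr' <|
      heq.mono fun i hi => hi.symm

end Asymptotics

section InvLogRatio

variable {w : ℕ → ℝ≥0} {τ b : ℝ}

theorem invLogRatio_nonneg (hτ : τ ∈ convergenceInterval w) (hτ0 : 0 < τ) :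
    0 ≤ invLogRatio (rho w) (ENNReal.ofReal τ) := by
  rw [invLogRatio]
  split_ifs with h
  · rfl
  · rw [ENNReal.toReal_ofReal hτ0.le]
    have hlt := (ENNReal.ofReal_lt_iff_lt_toReal hτ0.le h).1 hτ.2
    exact one_div_nonneg.2 (Real.log_nonneg ((one_le_div hτ0).2 hlt.le))

theorem continuousAt_mul_log_div {r : ℝ} (hτ0 : 0 < τ) (hr : 0 < r) :
    ContinuousAt (fun r => b * Real.log (r / τ)) r :=
  ((continuousAt_id.div_const τ).log (div_pos hr hτ0).ne').const_mul b

theorem exists_mem_convergenceInterval_one_lt_mul_log (hτ : τ ∈ convergenceInterval w)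
    (hτ0 : 0 < τ) (hb : invLogRatio (rho w) (ENNReal.ofReal τ) < b) :
    ∃ r ∈ convergenceInterval w, τ < r ∧ 1 < b * Real.log (r / τ) := by
  have hb0 : 0 < b := (invLogRatio_nonneg hτ hτ0).trans_lt hb
  rw [invLogRatio] at hb
  split_ifs at hb with h
  · refine ⟨τ * Real.exp (2 / b), ⟨by positivity, by simp [h]⟩,
      lt_mul_of_one_lt_right hτ0 (Real.one_lt_exp_iff.2 (by positivity)), ?_⟩
    rw [mul_div_cancel_left₀ _ hτ0.ne', Real.log_exp, mul_div_cancel₀ _ hb0.ne']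
    exact one_lt_two
  · have hlt := (ENNReal.ofReal_lt_iff_lt_toReal hτ0.le h).1 hτ.2
    rw [ENNReal.toReal_ofReal hτ0.le, div_lt_iff₀ (Real.log_pos ((one_lt_div hτ0).2 hlt))] at hb
    have hnear := ((continuousAt_mul_log_div hτ0 (hτ0.trans hlt)).eventually_const_lt hb).and
      (eventually_gt_nhds hlt)
    obtain ⟨r, hrρ, hbr, hτr⟩ := (eventually_mem_nhdsWithin.and
      (hnear.filter_mono (nhdsWithin_le_nhds (s := Set.Iio (rho w).toReal)))).exists
    have hr0 := hτ0.le.trans hτr.le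
    exact ⟨r, ⟨hr0, (ENNReal.ofReal_lt_iff_lt_toReal hr0 h).2 hrρ⟩, hτr, hbr⟩

theorem exists_gt_rho_mul_log_lt_one (hτ : τ ∈ convergenceInterval w) (hτ0 : 0 < τ)
    (hb0 : 0 ≤ b) (hb : b < invLogRatio (rho w) (ENNReal.ofReal τ)) :
    ∃ r > 0, rho w < ENNReal.ofReal r ∧ b * Real.log (r / τ) < 1 := by
  rw [invLogRatio] at hb
  split_ifs at hb with h
  · exact absurd hb hb0.not_gt
  · have hlt := (ENNReal.ofReal_lt_iff_lt_toReal hτ0.le h).1 hτ.2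
    rw [ENNReal.toReal_ofReal hτ0.le, lt_div_iff₀ (Real.log_pos ((one_lt_div hτ0).2 hlt))] at hb
    have hnear := (continuousAt_mul_log_div hτ0 (hτ0.trans hlt)).eventually_lt_const hb
    obtain ⟨r, hρr, hbr⟩ := (eventually_mem_nhdsWithin.and
      (hnear.filter_mono (nhdsWithin_le_nhds (s := Set.Ioi (rho w).toReal)))).exists
    exact ⟨r, ENNReal.toReal_nonneg.trans_lt hρr, (ENNReal.lt_ofReal_iff_toReal_lt h).2 hρr, hbr⟩

theorem eventually_inv_pow_le_weight {r : ℝ} (hr : 0 < r) (hρr : rho w < ENNReal.ofReal r)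
    (hroot : Tendsto (fun k : ℕ => (w k : ℝ≥0∞) ^ (1 / (k : ℝ))) atTop (𝓝 (rho w)⁻¹)) :
    ∀ᶠ k : ℕ in atTop, (r ^ k)⁻¹ ≤ (w k : ℝ) := by
  filter_upwards [hroot.eventually_const_lt (ENNReal.inv_lt_inv.2 hρr),
    eventually_ne_atTop 0] with k hk hk0
  have hpow := pow_le_pow_left' hk.le k
  rw [← ENNReal.rpow_natCast (_ ^ (1 / (k : ℝ))), ← ENNReal.rpow_mul,
    one_div_mul_cancel (Nat.cast_ne_zero.2 hk0), ENNReal.rpow_one,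
    ← ENNReal.ofReal_inv_of_pos hr, ← ENNReal.ofReal_pow (by positivity),
    ← ENNReal.ofReal_coe_nnreal, ENNReal.ofReal_le_ofReal_iff (by positivity)] at hpow
  rwa [← inv_pow]

end InvLogRatio

section OrderStatisticTails

variable {w : ℕ → ℝ≥0} {ι : Type*} {l : Filter ι} {T : ι → ℝ} {τ b C : ℝ} {m n : ι → ℕ}

theorem tendsto_measure_le_nthLargest (hw0 : 0 < w 0) (hτ : τ ∈ convergenceInterval w)
    (hτ0 : 0 < τ) (hT : Tendsto T l (𝓝 τ)) (hn : Tendsto n l atTop) (hC : 0 < C)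
    (hdom : ∀ᶠ i in l, TiltDominated w (m i) (n i) (T i) C)
    {j : ℕ} (hj : 1 ≤ j) (hb : invLogRatio (rho w) (ENNReal.ofReal τ) < b) :
    Tendsto (fun i => allocLaw w (m i) (n i) {y | b * Real.log (n i) ≤ nthLargest y j}) l
      (𝓝 0) := by
  have hb0 : 0 < b := (invLogRatio_nonneg hτ hτ0).trans_lt hb
  obtain ⟨r, hr, hτr, hbr⟩ := exists_mem_convergenceInterval_one_lt_mul_log hτ hτ0 hb
  have hr0 := hτ0.trans hτr
  rw [← inv_div, Real.log_inv, mul_neg, lt_neg] at hbr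
  have hlim := ENNReal.tendsto_ofReal ((tendsto_natCast_mul_pow_ceil_zero hn (hT.div_const r)
    (div_pos hτ0 hr0) hb0.le hbr).const_mul (C * (realGen w r / w 0)))
  rw [mul_zero, ENNReal.ofReal_zero] at hlim
  refine tendsto_of_tendsto_of_tendsto_of_le_of_le' tendsto_const_nhds hlim
    (.of_forall fun _ => zero_le) ?_
  filter_upwards [hdom, hT.eventually_mem (convergenceInterval_mem_nhds hτ hτ0),
    hT.eventually_lt_const hτr, hn.eventually_ge_atTop 2] with i hdomi hTi hTr hni
  have hK : 0 < ⌈b * Real.log (n i)⌉₊ :=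
    Nat.ceil_pos.2 (mul_pos hb0 (Real.log_pos (by exact_mod_cast hni)))
  simp only [← Nat.ceil_le]
  refine (hdomi.measure_le_nthLargest_le hni hj hK).trans (ENNReal.ofReal_le_ofReal ?_)
  calc _ ≤ n i * (C * (realGen w r / w 0 * (T i / r) ^ ⌈b * Real.log (n i)⌉₊)) := by
        gcongr
        exact tsum_indicator_Ici_tilt_le hw0 hTi hr hr0 hTr.le _
    _ = _ := by ring

theorem tendsto_natCast_mul_tilt_ceil_atTop (hw0 : 0 < w 0) (hτ : τ ∈ convergenceInterval w)
    (hτ0 : 0 < τ) (hT : Tendsto T l (𝓝 τ)) (hn : Tendsto n l atTop)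
    (hroot : Tendsto (fun k : ℕ => (w k : ℝ≥0∞) ^ (1 / (k : ℝ))) atTop (𝓝 (rho w)⁻¹))
    (hb0 : 0 < b) (hb : b < invLogRatio (rho w) (ENNReal.ofReal τ)) :
    Tendsto (fun i => n i * tilt w (T i) ⌈b * Real.log (n i)⌉₊) l atTop := by
  obtain ⟨r, hr0, hρr, hbr⟩ := exists_gt_rho_mul_log_lt_one hτ hτ0 hb0.le hb
  rw [← inv_div, Real.log_inv, mul_neg, neg_lt] at hbr
  have hK : Tendsto (fun i => ⌈b * Real.log (n i)⌉₊) l atTop :=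
    tendsto_nat_ceil_atTop.comp ((Real.tendsto_log_atTop.comp
      (tendsto_natCast_atTop_atTop.comp hn)).const_mul_atTop hb0)
  have hgen := continuousOn_realGen.continuousAt (convergenceInterval_mem_nhds hτ hτ0)
  have hpos := realGen_pos hw0 hτ
  refine tendsto_atTop_mono' l ?_ ((tendsto_natCast_mul_pow_ceil_atTop hn (hT.div_const r)
    (div_pos hτ0 hr0) hb0.le hbr).atTop_mul_pos (inv_pos.2 hpos)
      ((hgen.tendsto.comp hT).inv₀ hpos.ne'))
  filter_upwards [hK.eventually (eventually_inv_pow_le_weight hr0 hρr hroot),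
    hT.eventually_mem (convergenceInterval_mem_nhds hτ hτ0)] with i hwi hTi
  have hTi0 := hTi.1
  have hgeni := realGen_pos hw0 hTi
  rw [tilt, Function.comp_apply, div_pow, div_eq_inv_mul (T i ^ _), mul_assoc, ← div_eq_mul_inv]
  gcongr

theorem tendsto_measure_nthLargest_lt (hw0 : 0 < w 0) (hτ : τ ∈ convergenceInterval w)
    (hτ0 : 0 < τ) (hT : Tendsto T l (𝓝 τ)) (hn : Tendsto n l atTop) (hC : 0 < C)
    (hdom : ∀ᶠ i in l, TiltDominated w (m i) (n i) (T i) C)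
    (hroot : Tendsto (fun k : ℕ => (w k : ℝ≥0∞) ^ (1 / (k : ℝ))) atTop (𝓝 (rho w)⁻¹))
    {j : ℕ} (hj : 1 ≤ j) (hb0 : 0 < b) (hb : b < invLogRatio (rho w) (ENNReal.ofReal τ)) :
    Tendsto (fun i => allocLaw w (m i) (n i) {y | (nthLargest y j : ℝ) < b * Real.log (n i)}) l
      (𝓝 0) := by
  have hexp : Tendsto (fun i => Real.exp
      (1 - n i * tilt w (T i) ⌈b * Real.log (n i)⌉₊ / (2 * j))) l (𝓝 0) :=
    Real.tendsto_exp_atBot.comp (tendsto_const_nhds.add_atBot (tendsto_neg_atTop_atBot.comp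
      ((tendsto_natCast_mul_tilt_ceil_atTop hw0 hτ hτ0 hT hn hroot hb0 hb).atTop_div_const
        (by positivity))))
  have hlim := ENNReal.tendsto_ofReal ((hexp.const_mul C).const_mul (j : ℝ))
  rw [mul_zero, mul_zero, ENNReal.ofReal_zero] at hlim
  refine tendsto_of_tendsto_of_tendsto_of_le_of_le' tendsto_const_nhds hlim
    (.of_forall fun _ => zero_le) ?_
  filter_upwards [hdom, hT.eventually_mem (convergenceInterval_mem_nhds hτ hτ0),
    hn.eventually_ge_atTop 2] with i hdomi hTi hni
  have hK : 0 < ⌈b * Real.log (n i)⌉₊ :=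
    Nat.ceil_pos.2 (mul_pos hb0 (Real.log_pos (by exact_mod_cast hni)))
  simp only [← Nat.lt_ceil]
  exact hdomi.measure_nthLargest_lt_le_exp hC.le hw0 hTi hj hK

end OrderStatisticTails

end BallsInBoxes

open BallsInBoxes

theorem mainTheorem9 (w : ℕ → ℝ≥0) (hw0 : 0 < w 0) (hw : ∃ k, 1 ≤ k ∧ 0 < w k)
    (m n : ℕ → ℕ) (lam : ℝ)
    (hn : Filter.Tendsto n Filter.atTop Filter.atTop)
    (hmn : Filter.Tendsto (fun i => (m i : ℝ) / (n i : ℝ)) Filter.atTop (𝓝 lam))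
    (hZ : ∀ i, 0 < BallsInBoxes.partitionFun w (m i) (n i))
    (hlam : 0 < lam) (hnu : ENNReal.ofReal lam < BallsInBoxes.nu w) :
    ∃ τ : ℝ≥0∞,
      (0 < τ ∧ τ < BallsInBoxes.rho w ∧ BallsInBoxes.Psi w τ = ENNReal.ofReal lam ∧
        ∀ s ≤ BallsInBoxes.rho w, BallsInBoxes.Psi w s = ENNReal.ofReal lam → s = τ) ∧
      (∃ X : ∀ i, (Fin (n i) → ℕ) → ℝ,
        BallsInBoxes.IsLittleOp (fun i => BallsInBoxes.allocLaw w (m i) (n i)) X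
          (fun i => Real.log (n i)) ∧
        ∀ i y, (BallsInBoxes.nthLargest y 1 : ℝ) ≤
          BallsInBoxes.invLogRatio (BallsInBoxes.rho w) τ * Real.log (n i) + X i y) ∧
      (BallsInBoxes.rho w = ⊤ →
        BallsInBoxes.IsLittleOp (fun i => BallsInBoxes.allocLaw w (m i) (n i))
          (fun _ y => (BallsInBoxes.nthLargest y 1 : ℝ)) (fun i => Real.log (n i))) ∧
      (Filter.Tendsto (fun k : ℕ => (w k : ℝ≥0∞) ^ (1 / (k : ℝ))) Filter.atTop
          (𝓝 (BallsInBoxes.rho w)⁻¹) →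
        ∀ j : ℕ, 1 ≤ j →
          BallsInBoxes.TendstoInProb (fun i => BallsInBoxes.allocLaw w (m i) (n i))
            (fun i y => (BallsInBoxes.nthLargest y j : ℝ) / Real.log (n i))
            (BallsInBoxes.invLogRatio (BallsInBoxes.rho w) τ)) := by
  obtain ⟨τ, hτ, hτ0, rfl⟩ := exists_realPsi_eq hw0 hw hlam hnu
  obtain ⟨T, hT, hTmn⟩ := exists_tendsto_realPsi_eq hw0 hw hτ hτ0 hmn
  obtain ⟨C, hC, hdom⟩ := exists_eventually_tiltDominated hw0 hw hτ hτ0 hT hn hTmn (.of_forall hZ)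
  have hlog : ∀ᶠ i in atTop, 0 < Real.log (n i) :=
    (hn.eventually_ge_atTop 2).mono fun i hi => Real.log_pos (by exact_mod_cast hi)
  have hupper {j : ℕ} (hj : 1 ≤ j) (b : ℝ) :=
    tendsto_measure_le_nthLargest (b := b) hw0 hτ hτ0 hT hn hC hdom hj
  refine ⟨ENNReal.ofReal τ, ⟨ENNReal.ofReal_pos.2 hτ0, hτ.2, Psi_ofReal hw0 hτ,
    fun s hs h => eq_ofReal_of_Psi_eq hw0 hw hτ hnu hs h⟩, ?_, fun htop => ?_, fun hroot j hj => ?_⟩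
  · exact ⟨_, isLittleOp_max_sub_of_upper_tail hlog (hupper le_rfl),
      fun i y => sub_le_iff_le_add'.1 (le_max_left _ _)⟩
  · rw [invLogRatio, if_pos htop] at hupper
    exact tendstoInProb_div_of_tails hlog (fun _ _ => Nat.cast_nonneg _) (hupper le_rfl)
      fun b hb0 hb => absurd hb hb0.not_gt
  · exact tendstoInProb_div_of_tails hlog (fun _ _ => Nat.cast_nonneg _) (hupper hj)
      fun b => tendsto_measure_nthLargest_lt hw0 hτ hτ0 hT hn hC hdom hroot hj
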